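/- For positive integers $m_1, m_2$ with $m_2$ even, write $\mathbf{m}=(m_1,m_2)$ and let $$I^{(\mathbf{m})}=\{(i_1,i_2)\in\mathbb{N}_0^2:\ 0\le i_1\le m_1,\ 0\le i_2<2m_2,\ i_2<m_2 \text{ if } i_1\in\{0,m_1\},\ i_1+i_2 \text{ even}\},$$ with the nodes $(\theta_{i_1},\varphi_{i_2})=(i_1\pi/m_1,\ i_2\pi/m_2)$, $\mathbf{i}\in I^{(\mathbf{m})}$, which are the spherical coordinates of the spherical Lissajous nodes. For $\gamma\in\mathbb{Z}^2$ let $$X_\gamma(\theta,\varphi)=\begin{cases}\cos(\gamma_1\theta)\,e^{\mathrm{i}\gamma_2\varphi}, & \gamma_2\text{ even},\\ \mathrm{i}\sin(\gamma_1\theta)\,e^{\mathrm{i}\gamma_2\varphi}, & \gamma_2 \text{ odd},\end{cases}\qquad (\theta,\varphi)\in[0,\pi]\times[0,2\pi],$$ and let $\Pi^{(\mathbf{m})}$ be the complex span of the $X_\gamma$ with $\gamma\in\Gamma^{(\mathbf{m})}=\overline{\Gamma}^{(\mathbf{m})}\setminus\{\gamma\in\overline{\Gamma}^{(\mathbf{m})}:\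 \gamma_1/m_1+\gamma_2/m_2=1,\ \gamma_2\ne0\}$, where $$\overline{\Gamma}^{(\mathbf{m})}=\{\gamma\in\mathbb{Z}^2:\ 1\le\gamma_1\le m_1,\ \gamma_1/m_1+|\gamma_2|/m_2\le1\}\cup\{(0,\gamma_2):\ \gamma_2\in2\mathbb{Z},\ |\gamma_2|<m_2\}.$$ Then, for every $f:I^{(\mathbf{m})}\to\mathbb{C}$, there is a unique $P_f^{(\mathbf{m})}\in\Pi^{(\mathbf{m})}$ with $P_f^{(\mathbf{m})}(\theta_{i_1},\varphi_{i_2})=f(\mathbf{i})$ for all $\mathbf{i}\in I^{(\mathbf{m})}$. Let $C(\mathbb{S}^2)$ be the space of continuous functions $F:[0,\pi]\times[0,2\pi]\to\mathbb{C}$ with $F(\theta,0)=F(\theta,2\pi)$ for all $\theta$ and with $F(0,\cdot)$ and $F(\pi,\cdot)$ constant (the continuous functions on the unit sphere, in spherical coordinates), and define the Lebesgue constant (absolute condition number) of the interpolation problem by $$\Lambda^{(\mathbf{m})}=\sup\{\|P_f^{(\mathbf{m})}\|_\infty:\ F\in C(\mathbb{S}^2),\ \|F\|_\infty\le1,\ f(\mathbf{i})=F(\theta_{i_1},\varphi_{i_2})\text{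 for } \mathbf{i}\in I^{(\mathbf{m})}\},$$ where $\|\cdot\|_\infty$ is the supremum norm on $[0,\pi]\times[0,2\pi]$. There is a constant $C>0$, independent of $\mathbf{m}$, such that for all positive integers $m_1,m_2$ with $m_2$ even $$\Lambda^{(\mathbf{m})}\le C\,\ln(m_1+1)\,\ln(m_2+1).$$ -/

import Mathlib

open Real

namespace SphericalLissajous

/-- The closed rectangle `[0, π] × [0, 2π]` of spherical coordinates `(θ, φ)`. -/
abbrev Rect : Type := Set.Icc (0 : ℝ) π × Set.Icc (0 : ℝ) (2 * π)

/-- The index set `I^(m)`: pairs `(i₁, i₂)` with `0 ≤ i₁ ≤ m₁`, `0 ≤ i₂ < 2 m₂`,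
`i₂ < m₂` if `i₁ ∈ {0, m₁}`, and `i₁ + i₂` even. -/
def indexSet (m₁ m₂ : ℕ) : Finset (ℕ × ℕ) :=
  (Finset.range (m₁ + 1) ×ˢ Finset.range (2 * m₂)).filter fun i =>
    ((i.1 = 0 ∨ i.1 = m₁) → i.2 < m₂) ∧ Even (i.1 + i.2)

/-- The node `(θ_{i₁}, φ_{i₂}) = (i₁ π / m₁, i₂ π / m₂)` with index `i ∈ I^(m)`,
in spherical coordinates. -/
noncomputable def node (m₁ m₂ : ℕ) (i : indexSet m₁ m₂) : Rect :=
  (⟨(i.1.1 : ℝ) / m₁ * π, by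
      have h := i.2
      simp only [indexSet, Finset.mem_filter, Finset.mem_product, Finset.mem_range] at h
      have h1 : (i.1.1 : ℝ) ≤ m₁ := by exact_mod_cast Nat.lt_succ_iff.mp h.1.1
      exact ⟨by positivity,
        mul_le_of_le_one_left pi_pos.le (div_le_one_of_le₀ h1 (Nat.cast_nonneg _))⟩⟩,
   ⟨(i.1.2 : ℝ) / m₂ * π, by
      have h := i.2
      simp only [indexSet, Finset.mem_filter, Finset.mem_product, Finset.mem_range] at h
      have h1 : (i.1.2 : ℝ) ≤ 2 * m₂ := by exact_mod_cast h.1.2.le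
      exact ⟨by positivity,
        mul_le_mul_of_nonneg_right (div_le_of_le_mul₀ (Nat.cast_nonneg _) (by norm_num) h1)
          pi_pos.le⟩⟩)

/-- The larger spectral index set (a subset of `ℕ₀ × ℤ`, realised in `ℤ × ℤ`). -/
def bigSpectralSet (m₁ m₂ : ℕ) : Set (ℤ × ℤ) :=
  {γ | 1 ≤ γ.1 ∧ γ.1 ≤ m₁ ∧ (γ.1 : ℝ) / m₁ + |(γ.2 : ℝ)| / m₂ ≤ 1} ∪
    {γ | γ.1 = 0 ∧ Even γ.2 ∧ |γ.2| < m₂}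

/-- The part of the upper boundary that is removed from the larger spectral index set. -/
def upperSpectralSet (m₁ m₂ : ℕ) : Set (ℤ × ℤ) :=
  {γ | γ ∈ bigSpectralSet m₁ m₂ ∧ (γ.1 : ℝ) / m₁ + (γ.2 : ℝ) / m₂ = 1 ∧ γ.2 ≠ 0}

/-- The spectral index set `Γ^(m)`. -/
def spectralSet (m₁ m₂ : ℕ) : Set (ℤ × ℤ) :=
  bigSpectralSet m₁ m₂ \ upperSpectralSet m₁ m₂

/-- The parity-modified double Fourier basis function `X_γ` on the rectangle of
spherical coordinates. -/
noncomputable def fourierBasis (γ : ℤ × ℤ) : C(Rect, ℂ) where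
  toFun p :=
    if Even γ.2 then
      (Real.cos (γ.1 * (p.1 : ℝ)) : ℂ) * Complex.exp (Complex.I * γ.2 * ((p.2 : ℝ) : ℂ))
    else
      Complex.I * (Real.sin (γ.1 * (p.1 : ℝ)) : ℂ) *
        Complex.exp (Complex.I * γ.2 * ((p.2 : ℝ) : ℂ))
  continuous_toFun := by
    split_ifs <;> fun_prop

/-- The interpolation space `Π^(m)`, the complex span of the `X_γ` with `γ ∈ Γ^(m)`. -/
noncomputable def interpolationSpace (m₁ m₂ : ℕ) : Submodule ℂ C(Rect, ℂ) :=
  Submodule.span ℂ (fourierBasis '' spectralSet m₁ m₂)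

/-- `P` solves the interpolation problem in `Π^(m)` for the data `f` on `I^(m)`. -/
def IsInterpolant (m₁ m₂ : ℕ) (f : indexSet m₁ m₂ → ℂ) (P : C(Rect, ℂ)) : Prop :=
  P ∈ interpolationSpace m₁ m₂ ∧ ∀ i : indexSet m₁ m₂, P (node m₁ m₂ i) = f i

/-- The space `C(𝕊²)` of continuous functions on the unit sphere in spherical coordinates:
continuous functions on `[0, π] × [0, 2π]` that are periodic in `φ` and constant on each of the
lines `θ = 0` and `θ = π`, which describe the poles. -/
def sphereFunctions : Set C(Rect, ℂ) :=
  {F | (∀ (θ : Set.Icc (0 : ℝ) π) (φ₁ φ₂ : Set.Icc (0 : ℝ) (2 * π)),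
          (φ₁ : ℝ) = 0 → (φ₂ : ℝ) = 2 * π → F (θ, φ₁) = F (θ, φ₂)) ∧
       (∀ (θ : Set.Icc (0 : ℝ) π) (φ₁ φ₂ : Set.Icc (0 : ℝ) (2 * π)),
          (θ : ℝ) = 0 → F (θ, φ₁) = F (θ, φ₂)) ∧
       (∀ (θ : Set.Icc (0 : ℝ) π) (φ₁ φ₂ : Set.Icc (0 : ℝ) (2 * π)),
          (θ : ℝ) = π → F (θ, φ₁) = F (θ, φ₂))}

/-- The Lebesgue constant `Λ^(m)`: the supremum of `‖P‖_∞` over all interpolants `P` of samples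
of functions `F ∈ C(𝕊²)` with `‖F‖_∞ ≤ 1`. It is formed in `[0, ∞]`, so that it cannot take a
default value. -/
noncomputable def lebesgueConstant (m₁ m₂ : ℕ) : ENNReal :=
  ⨆ (F : C(Rect, ℂ)) (_ : F ∈ sphereFunctions ∧ ‖F‖ ≤ 1) (P : C(Rect, ℂ))
    (_ : IsInterpolant m₁ m₂ (fun i => F (node m₁ m₂ i)) P), ‖P‖ₑ

end SphericalLissajous

/-!
In the doubled variables `X_γ(x, y)` is the average of the exponential `e^{i(γ₁ x + γ₂ y)}` over the
glide reflection `(x, y) ↦ (-x, y + π)` of the torus. The nodes, together with their images, are a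
subgroup of the torus with `2 m₁ m₂` elements, and the glide reflection acts on it without fixed
points because `m₂` is even. Interpolation is therefore the discrete Fourier transform on that
subgroup, restricted to invariant functions.

Two frequencies agree on the subgroup exactly when they differ by a multiple `(p m₁, q m₂)` with
`p + q` even, and the rhombus `|γ₁| / m₁ + |γ₂| / m₂ ≤ 1` with half of its boundary represents each
class once: moving its upper half down by `(±m₁, -m₂)` gives a box
(`sum_frequencySet_eq_sum_box`). Hence the kernel of the rhombus is a Kronecker delta on the
subgroup (`kernelSum_frequencySet_node`) and its symmetrized translates are cardinal functions
(`cardinalFun_node`). They give existence, and uniqueness follows because the spectral set has at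
most `m₁ m₂` elements and there are at least `m₁ m₂` nodes (`eq_zero_of_vanishing`).

The Lebesgue function is thereby bounded by the sum, over the nodes, of the moduli of the
translates of the rhombic Dirichlet kernel. A row `m₁ |γ₂| < m₂ (m₁ - |γ₁|)` of the rhombus has
rational endpoints. Averaging over the `m₁` preimages `t` of `y` under multiplication by `m₁`
(`kernelSum_eq_average`) replaces it by the integers `|l| < m₂ (m₁ - |γ₁|)`. The new rows can be
summed in closed form, which leaves geometric sums in `x ± m₂ t` divided by `sin (t / 2)`. The nodes
in the first variable contribute `m₁ log (m₁ + 1)`. Those in the second variable and the `m₁`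
preimages together form an equidistant grid of `2 m₁ m₂` points, so that they contribute
`m₁ m₂ log (m₁ m₂)` (both by `sum_peak_le`). This gives `log (m₁ + 1) log (2 m₁ m₂ + 1)`, which is
of the required size if `m₁ ≤ m₂`; otherwise the roles of the two axes are exchanged
(`nodalNorm_openRhombus_le`).
-/

namespace SphericalLissajous

/-! ### Exponential sums in one variable -/

/-- The unimodular exponential `t ↦ e^{it}` of a real variable. -/
noncomputable def expI (t : ℝ) : ℂ := Complex.exp (t * Complex.I)

lemma expI_add (s t : ℝ) : expI (s + t) = expI s * expI t := by
  simp only [expI, ← Complex.exp_add]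
  push_cast
  ring_nf

lemma norm_expI (t : ℝ) : ‖expI t‖ = 1 := Complex.norm_exp_ofReal_mul_I t

lemma expI_zero : expI 0 = 1 := by simp [expI]

lemma conj_expI (t : ℝ) : (starRingEnd ℂ) (expI t) = expI (-t) := by
  simp [expI, ← Complex.exp_conj]

lemma expI_nat_mul (n : ℕ) (t : ℝ) : expI (n * t) = expI t ^ n := by
  simp only [expI, ← Complex.exp_nat_mul]
  push_cast
  ring_nf

lemma expI_two_pi_mul_int (n : ℤ) : expI (2 * π * n) = 1 := by
  rw [expI, Complex.exp_eq_one_iff]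
  exact ⟨n, by push_cast; ring⟩

lemma expI_eq_one_iff (t : ℝ) : expI t = 1 ↔ ∃ n : ℤ, t = 2 * π * n := by
  constructor
  · intro h
    rw [expI, Complex.exp_eq_one_iff] at h
    obtain ⟨n, hn⟩ := h
    refine ⟨n, ?_⟩
    have h2 : (t : ℂ) * Complex.I = ((2 * π * n : ℝ) : ℂ) * Complex.I := by
      rw [hn]; push_cast; ring
    exact_mod_cast mul_right_cancel₀ Complex.I_ne_zero h2
  · rintro ⟨n, rfl⟩
    exact expI_two_pi_mul_int n

lemma norm_expI_sub_one (t : ℝ) : ‖expI t - 1‖ = 2 * |Real.sin (t / 2)| := by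
  rw [expI, mul_comm, Complex.norm_exp_I_mul_ofReal_sub_one, norm_mul, Real.norm_eq_abs,
    Real.norm_eq_abs, abs_two]

/-- Orthogonality of the `n`-th roots of unity. -/
lemma sum_expI_roots (n : ℕ) (hn : 0 < n) (l : ℤ) :
    ∑ k ∈ Finset.range n, expI (2 * π * k * l / n) = if (n : ℤ) ∣ l then (n : ℂ) else 0 := by
  have hn' : (n : ℝ) ≠ 0 := by positivity
  have h1 : ∀ k ∈ Finset.range n, expI (2 * π * k * l / n) = expI (2 * π * l / n) ^ k := by
    intro k _
    rw [← expI_nat_mul]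
    congr 1
    ring
  rw [Finset.sum_congr rfl h1]
  split_ifs with h
  · obtain ⟨q, rfl⟩ := h
    have : expI (2 * π * ((n * q : ℤ) : ℝ) / n) = 1 := by
      rw [← expI_two_pi_mul_int q]
      congr 1
      push_cast
      field_simp
    simp only [this, one_pow]
    simp
  · have hne : expI (2 * π * l / n) ≠ 1 := by
      intro h1
      obtain ⟨q, hq⟩ := (expI_eq_one_iff _).1 h1
      apply h
      refine ⟨q, ?_⟩
      have h2 : (l : ℝ) = n * q := by
        field_simp at hq
        exact hq
      exact_mod_cast h2
    rw [geom_sum_eq hne, ← expI_nat_mul]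
    have : (n : ℝ) * (2 * π * l / n) = 2 * π * l := by field_simp
    rw [this, expI_two_pi_mul_int, sub_self, zero_div]

/-- A majorant, up to a factor of `2`, of `min M (1 / |sin s|)`; unlike this minimum it needs no
convention at the zeros of the sine. -/
noncomputable def peak (M : ℕ) (s : ℝ) : ℝ := 2 * M / (1 + M * |Real.sin s|)

lemma peak_nonneg (M : ℕ) (s : ℝ) : 0 ≤ peak M s := by
  unfold peak; positivity

lemma peak_neg (M : ℕ) (s : ℝ) : peak M (-s) = peak M s := by
  simp [peak]

lemma peak_add_pi (M : ℕ) (s : ℝ) : peak M (s + π) = peak M s := by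
  simp [peak, Real.sin_add_pi]

lemma le_mul_peak {M : ℕ} {s g q : ℝ} (h1 : g ≤ q * M) (h2 : |Real.sin s| * g ≤ q) :
    g ≤ q * peak M s := by
  have h3 : 0 < 1 + M * |Real.sin s| := by positivity
  rw [peak, ← mul_div_assoc, le_div_iff₀ h3]
  nlinarith [mul_le_mul_of_nonneg_left h2 (Nat.cast_nonneg (α := ℝ) M)]

lemma norm_geom_sum_le_peak {n M : ℕ} (h : n ≤ M) (s : ℝ) :
    ‖∑ j ∈ Finset.range n, expI (j * s)‖ ≤ peak M (s / 2) := by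
  have h0 : ∀ m : ℕ, ‖∑ j ∈ Finset.range m, expI (j * s)‖ ≤ m := fun m => by
    refine (norm_sum_le _ _).trans ?_
    simp [norm_expI]
  rw [← one_mul (peak M (s / 2))]
  refine le_mul_peak ((h0 n).trans (by rw [one_mul]; exact_mod_cast h)) ?_
  have h1 : (∑ j ∈ Finset.range n, expI (j * s)) * (expI s - 1) = expI (n * s) - 1 := by
    simp only [expI_nat_mul]
    exact geom_sum_mul _ _
  have h2 := congrArg norm h1
  rw [norm_mul, norm_expI_sub_one, norm_expI_sub_one] at h2
  nlinarith [Real.abs_sin_le_one (n * s / 2)]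

/-- The sum of an `M`-periodic sequence over `M` consecutive indices does not change under a shift
by one. -/
lemma sum_range_add_one_of_periodic {M : ℕ} {g : ℤ → ℝ} (hg : ∀ n, g (n + M) = g n) (c : ℤ) :
    ∑ j ∈ Finset.range M, g (j + (c + 1)) = ∑ j ∈ Finset.range M, g (j + c) := by
  have h1 := Finset.sum_range_succ (fun j : ℕ => g (j + c)) M
  rw [Finset.sum_range_succ'] at h1
  have h2 := hg c
  have h3 : ∀ j ∈ Finset.range M, g (j + (c + 1)) = g ((j + 1 : ℕ) + c) := fun j _ => by
    congr 1; push_cast; ring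
  rw [Finset.sum_congr rfl h3]
  simp only [Nat.cast_zero, zero_add] at h1
  rw [add_comm] at h2
  linarith

lemma sum_range_add_of_periodic {M : ℕ} {g : ℤ → ℝ} (hg : ∀ n, g (n + M) = g n) (c : ℤ) :
    ∑ j ∈ Finset.range M, g (j + c) = ∑ j ∈ Finset.range M, g j := by
  induction c using Int.induction_on with
  | zero => simp
  | succ i ih => rw [sum_range_add_one_of_periodic hg, ih]
  | pred i ih =>
    rw [← ih, ← sum_range_add_one_of_periodic hg]
    simp

lemma sum_inv_le_log {M : ℕ} (hM : 0 < M) :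
    ∑ j ∈ Finset.range M, (1 / (1 + 2 * (j : ℝ))) ≤ 3 * Real.log (M + 1) := by
  have h1 : ∑ j ∈ Finset.range M, (1 / (1 + 2 * (j : ℝ))) ≤ (harmonic M : ℝ) := by
    rw [harmonic]
    push_cast
    refine Finset.sum_le_sum fun j _ => ?_
    rw [one_div]
    apply inv_anti₀ (by positivity)
    have : (0 : ℝ) ≤ j := Nat.cast_nonneg j
    linarith
  have h2 := harmonic_le_one_add_log M
  have hM' : (1 : ℝ) ≤ M := by exact_mod_cast hM
  have h3 : Real.log M ≤ Real.log (M + 1) := Real.log_le_log (by linarith) (by linarith)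
  have h4 : Real.log 2 ≤ Real.log (M + 1) := Real.log_le_log (by norm_num) (by linarith)
  have h5 := Real.log_two_gt_d9
  linarith

/-- The `j`-th point of a grid with `M` points in `[0, π]` keeps a distance proportional to `j / M`
or to `(M - 1 - j) / M` from the zeros of the sine. -/
lemma abs_sin_lower {M j : ℕ} (hj : j < M) {τ : ℝ} (h0 : 0 ≤ τ) (h1 : τ ≤ π / M) :
    min (2 * (j : ℝ)) (2 * ((M - 1 - j : ℕ) : ℝ)) ≤ M * |Real.sin (τ + π * j / M)| := by
  have hM : (0 : ℝ) < M := by exact_mod_cast (by omega : 0 < M)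
  have hj' : (j : ℝ) + 1 ≤ M := by exact_mod_cast hj
  have hj0 : (0 : ℝ) ≤ j := Nat.cast_nonneg j
  have hc : ((M - 1 - j : ℕ) : ℝ) = M - 1 - j := by
    rw [Nat.cast_sub (by omega), Nat.cast_sub (by omega)]; simp
  rw [hc]
  set u := τ + π * j / M with hu
  have hpi := Real.pi_pos
  have hu0 : π * j / M ≤ u := by linarith
  have hu1 : u ≤ π * (j + 1) / M := by
    rw [hu, mul_add, add_div]; simp only [mul_one]; linarith
  have hMu0 : π * j ≤ M * u := by
    rw [div_le_iff₀ hM] at hu0; linarith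
  have hMu1 : M * u ≤ π * (j + 1) := by
    rw [le_div_iff₀ hM] at hu1; linarith
  have hu0' : 0 ≤ u := by
    have : 0 ≤ π * j / M := by positivity
    linarith
  have hu1' : u ≤ π := by
    have : π * (j + 1) / M ≤ π := by
      rw [div_le_iff₀ hM]; nlinarith
    linarith
  rcases le_total u (π / 2) with h | h
  · refine (min_le_left _ _).trans ?_
    have h2 := Real.mul_le_sin hu0' h
    have h3 : 2 / π * u ≤ |Real.sin u| := h2.trans (le_abs_self _)
    have h4 : M * (2 / π * u) ≤ M * |Real.sin u| := mul_le_mul_of_nonneg_left h3 hM.le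
    have h5 : M * (2 / π * u) = 2 * (M * u) / π := by ring
    rw [h5] at h4
    refine le_trans ?_ h4
    rw [le_div_iff₀ hpi]; linarith
  · refine (min_le_right _ _).trans ?_
    have h2 := Real.mul_le_sin (x := π - u) (by linarith) (by linarith)
    rw [Real.sin_pi_sub] at h2
    have h3 : 2 / π * (π - u) ≤ |Real.sin u| := h2.trans (le_abs_self _)
    have h4 : M * (2 / π * (π - u)) ≤ M * |Real.sin u| := mul_le_mul_of_nonneg_left h3 hM.le
    have h5 : M * (2 / π * (π - u)) = 2 * (M * π - M * u) / π := by ring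
    rw [h5] at h4
    refine le_trans ?_ h4
    rw [le_div_iff₀ hpi]; nlinarith

lemma sum_peak_le_of_mem {M : ℕ} (hM : 0 < M) {τ : ℝ} (h0 : 0 ≤ τ) (h1 : τ ≤ π / M) :
    ∑ j ∈ Finset.range M, peak M (τ + π * j / M) ≤ 12 * M * Real.log (M + 1) := by
  have hM' : (0 : ℝ) < M := by exact_mod_cast hM
  have key : ∀ j ∈ Finset.range M, peak M (τ + π * j / M) ≤
      2 * M * (1 / (1 + 2 * (j : ℝ))) + 2 * M * (1 / (1 + 2 * ((M - 1 - j : ℕ) : ℝ))) := by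
    intro j hj
    have h2 := abs_sin_lower (Finset.mem_range.1 hj) h0 h1
    have hp1 : 0 ≤ 2 * (M : ℝ) * (1 / (1 + 2 * (j : ℝ))) := by positivity
    have hp2 : 0 ≤ 2 * (M : ℝ) * (1 / (1 + 2 * ((M - 1 - j : ℕ) : ℝ))) := by positivity
    rw [peak]
    rcases min_le_iff.1 h2 with h3 | h3
    · have : 2 * (M : ℝ) / (1 + M * |Real.sin (τ + π * j / M)|) ≤
          2 * M * (1 / (1 + 2 * (j : ℝ))) := by
        rw [mul_one_div]
        exact div_le_div_of_nonneg_left (by positivity) (by positivity) (by linarith)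
      linarith
    · have : 2 * (M : ℝ) / (1 + M * |Real.sin (τ + π * j / M)|) ≤
          2 * M * (1 / (1 + 2 * ((M - 1 - j : ℕ) : ℝ))) := by
        rw [mul_one_div]
        exact div_le_div_of_nonneg_left (by positivity) (by positivity) (by linarith)
      linarith
  refine (Finset.sum_le_sum key).trans ?_
  rw [Finset.sum_add_distrib, ← Finset.mul_sum, ← Finset.mul_sum,
    Finset.sum_range_reflect (fun j : ℕ => 1 / (1 + 2 * (j : ℝ)))]
  have := sum_inv_le_log hM
  nlinarith

/-- The one-dimensional source of the logarithms: the sum of `peak M` over `M` equidistant points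
in one period has size `M log (M + 1)`, wherever the grid is placed. -/
lemma sum_peak_le {M : ℕ} (hM : 0 < M) (τ : ℝ) :
    ∑ j ∈ Finset.range M, peak M (τ + π * j / M) ≤ 12 * M * Real.log (M + 1) := by
  have hM' : (0 : ℝ) < M := by exact_mod_cast hM
  have hw : (0 : ℝ) < π / M := by positivity
  -- Translating by a multiple of the grid width moves the offset into `[0, π / M]`.
  set c := ⌊τ / (π / M)⌋ with hc
  set τ' := τ - c * (π / M) with hτ'
  have h0 : 0 ≤ τ' := by
    have := Int.floor_le (τ / (π / M))
    rw [← hc, le_div_iff₀ hw] at this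
    linarith
  have h1 : τ' ≤ π / M := by
    have := (Int.lt_floor_add_one (τ / (π / M))).le
    rw [← hc, div_le_iff₀ hw] at this
    rw [hτ']
    linarith
  set g : ℤ → ℝ := fun n => peak M (τ' + π * n / M) with hg
  have hper : ∀ n, g (n + M) = g n := fun n => by
    simp only [hg]
    rw [← peak_add_pi M (τ' + π * n / M)]
    congr 1
    push_cast
    field_simp
    ring
  have h2 := sum_range_add_of_periodic hper c
  have h3 := sum_peak_le_of_mem hM h0 h1
  refine le_trans (le_of_eq ?_) h3
  refine Eq.trans (Finset.sum_congr rfl fun j _ => ?_)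
    (h2.trans (Finset.sum_congr rfl fun j _ => ?_))
  · simp only [hg, hτ']
    congr 1
    push_cast
    field_simp
    ring
  · simp [hg]

/-! ### The Dirichlet kernel of the rhombus -/

/-- A symmetric integer interval splits into its nonnegative and its negative part. -/
lemma sum_Ioo_neg_succ {β : Type*} [AddCommMonoid β] (f : ℤ → β) (n : ℕ) :
    ∑ g ∈ Finset.Ioo (-((n + 1 : ℕ) : ℤ)) ((n + 1 : ℕ) : ℤ), f g =
      ∑ j ∈ Finset.range (n + 1), f j + ∑ j ∈ Finset.range n, f (-(j + 1 : ℕ)) := by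
  induction n with
  | zero =>
    have : Finset.Ioo (-((0 + 1 : ℕ) : ℤ)) ((0 + 1 : ℕ) : ℤ) = {0} := by
      ext x; simp; omega
    rw [this]; simp
  | succ n ih =>
    have : Finset.Ioo (-((n + 1 + 1 : ℕ) : ℤ)) ((n + 1 + 1 : ℕ) : ℤ) =
        insert (((n + 1 : ℕ) : ℤ)) (insert (-((n + 1 : ℕ) : ℤ))
          (Finset.Ioo (-((n + 1 : ℕ) : ℤ)) ((n + 1 : ℕ) : ℤ))) := by
      ext x; simp; omega
    rw [this, Finset.sum_insert (by simp; omega), Finset.sum_insert (by simp), ih,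
      Finset.sum_range_succ _ (n + 1), Finset.sum_range_succ (fun j : ℕ => f (-(j + 1 : ℕ))) n]
    abel

/-- A symmetric sum along two rays splits into two geometric sums. -/
lemma norm_sum_Ioo_le_peak {n M : ℕ} (h : n ≤ M) (x u : ℝ) :
    ‖∑ g ∈ Finset.Ioo (-(n : ℤ)) n, expI (g * x - |(g : ℝ)| * u)‖ ≤
      peak M ((x - u) / 2) + peak M ((x + u) / 2) := by
  rcases n with _ | n
  · simpa using add_nonneg (peak_nonneg M _) (peak_nonneg M _)
  rw [sum_Ioo_neg_succ]
  refine (norm_add_le _ _).trans (add_le_add ?_ ?_)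
  · refine le_trans (le_of_eq ?_) (norm_geom_sum_le_peak h (x - u))
    congr 1
    refine Finset.sum_congr rfl fun j _ => ?_
    congr 1
    simp only [Int.cast_natCast, Nat.abs_cast]
    ring
  · have h1 := norm_geom_sum_le_peak (n := n) (M := M) (by omega) (-(x + u))
    rw [neg_div, peak_neg] at h1
    refine le_trans (le_of_eq ?_) h1
    rw [← one_mul ‖∑ j ∈ Finset.range n, expI (j * -(x + u))‖, ← norm_expI (-(x + u)),
      ← norm_mul, Finset.mul_sum]
    congr 1
    refine Finset.sum_congr rfl fun j _ => ?_
    rw [← expI_add]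
    congr 1
    rw [show ((-((j + 1 : ℕ) : ℤ) : ℤ) : ℝ) = -((j : ℝ) + 1) by push_cast; ring, abs_neg,
      abs_of_nonneg (by positivity)]
    ring

/-- The rows of the open rhombus `b |g| + a |γ₂| < a b`, with the second frequency rescaled to
`l = a γ₂` and the divisibility of `l` by `a` dropped. -/
noncomputable def rowSum (a b : ℕ) (x t : ℝ) : ℂ :=
  ∑ g ∈ Finset.Ioo (-(a : ℤ)) a,
    ∑ l ∈ Finset.Ioo (-((b : ℤ) * (a - |g|))) (b * (a - |g|)), expI (g * x + l * t)

lemma sum_expI_Ioo_mul (A : ℤ) (hA : 0 < A) (t : ℝ) :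
    (∑ l ∈ Finset.Ioo (-A) A, expI (l * t)) * (expI t - 1) =
      expI (A * t) - expI (t - A * t) := by
  obtain ⟨n, rfl⟩ : ∃ n : ℕ, A = ((n + 1 : ℕ) : ℤ) := ⟨(A - 1).toNat, by omega⟩
  induction n with
  | zero =>
    have : Finset.Ioo (-((0 + 1 : ℕ) : ℤ)) ((0 + 1 : ℕ) : ℤ) = {0} := by
      ext x; simp; omega
    rw [this]
    simp [expI_zero]
  | succ n ih =>
    have : Finset.Ioo (-((n + 1 + 1 : ℕ) : ℤ)) ((n + 1 + 1 : ℕ) : ℤ) =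
        insert (((n + 1 : ℕ) : ℤ)) (insert (-((n + 1 : ℕ) : ℤ))
          (Finset.Ioo (-((n + 1 : ℕ) : ℤ)) ((n + 1 : ℕ) : ℤ))) := by
      ext x; simp; omega
    rw [this, Finset.sum_insert (by simp; omega), Finset.sum_insert (by simp), add_mul, add_mul,
      ih (by omega), mul_sub, mul_sub, ← expI_add, ← expI_add]
    push_cast
    ring_nf

/-- Away from the zeros of `sin (t / 2)`: the rows are summed in closed form. -/
lemma norm_rowSum_mul_sin_le (a b : ℕ) (hb : 0 < b) (x t : ℝ) :
    |Real.sin (t / 2)| * ‖rowSum a b x t‖ ≤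
      peak a ((x - b * t) / 2) + peak a ((x + b * t) / 2) := by
  have h1 : rowSum a b x t * (expI t - 1) =
      expI (a * b * t) * ∑ g ∈ Finset.Ioo (-(a : ℤ)) a, expI (g * x - |(g : ℝ)| * (b * t)) -
      expI (t - a * b * t) *
        ∑ g ∈ Finset.Ioo (-(a : ℤ)) a, expI (g * x - |(g : ℝ)| * (-(b * t))) := by
    rw [rowSum, Finset.sum_mul, Finset.mul_sum, Finset.mul_sum, ← Finset.sum_sub_distrib]
    refine Finset.sum_congr rfl fun g hg => ?_
    have hA : (0 : ℤ) < b * (a - |g|) := by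
      have : |g| < a := abs_lt.2 (Finset.mem_Ioo.1 hg)
      have hb' : (0 : ℤ) < b := by exact_mod_cast hb
      exact mul_pos hb' (by linarith)
    simp only [expI_add (g * x), ← Finset.mul_sum]
    rw [mul_assoc, sum_expI_Ioo_mul _ hA, mul_sub, ← expI_add, ← expI_add, ← expI_add, ← expI_add]
    push_cast
    ring_nf
  have h2 := congrArg norm h1
  rw [norm_mul, norm_expI_sub_one] at h2
  have h3 := norm_sum_Ioo_le_peak (le_refl a) x (b * t)
  have h4 := norm_sum_Ioo_le_peak (le_refl a) x (-(b * t))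
  have h5 := norm_sub_le
    (expI (a * b * t) * ∑ g ∈ Finset.Ioo (-(a : ℤ)) a, expI (g * x - |(g : ℝ)| * (b * t)))
    (expI (t - a * b * t) *
        ∑ g ∈ Finset.Ioo (-(a : ℤ)) a, expI (g * x - |(g : ℝ)| * (-(b * t))))
  rw [norm_mul, norm_mul, norm_expI, norm_expI, one_mul, one_mul, ← h2] at h5
  rw [sub_neg_eq_add, ← sub_eq_add_neg] at h4
  linarith

/-- Near the zeros of `sin (t / 2)`: the rhombus is summed by columns, that is, first over `g`. -/
lemma norm_rowSum_le (a b : ℕ) (hb : 0 < b) (x t : ℝ) :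
    ‖rowSum a b x t‖ ≤ 4 * (a * b) * peak a (x / 2) := by
  have hb' : (0 : ℤ) < b := by exact_mod_cast hb
  -- `|l| < b (a - |g|)` means `|g| < r` with `r` the ceiling of `(b a - |l|) / b`; the minimum with
  -- `a` only serves to make `r ≤ a` evident.
  have h1 : rowSum a b x t = ∑ l ∈ Finset.Ioo (-((b : ℤ) * a)) (b * a), expI (l * t) *
      ∑ g ∈ Finset.Ioo (-((min a ((b * a - |l| + b - 1) / b).toNat : ℕ) : ℤ))
        ((min a ((b * a - |l| + b - 1) / b).toNat : ℕ) : ℤ),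
        expI (g * x - |(g : ℝ)| * 0) := by
    simp only [Finset.mul_sum]
    rw [rowSum]
    refine (Finset.sum_comm' ?_).trans
      (Finset.sum_congr rfl fun l _ => Finset.sum_congr rfl fun g _ => ?_)
    · intro g l
      simp only [Finset.mem_Ioo, ← abs_lt]
      have h2 : |l| < b * (a - |g|) ↔ |g| < (b * a - |l| + b - 1) / b := by
        rw [← Int.add_one_le_iff (a := |g|), Int.le_ediv_iff_mul_le hb']
        constructor <;> intro h <;> nlinarith
      rw [h2]
      have h3 : (0 : ℤ) ≤ |g| := abs_nonneg g
      have h4 : |g| < (b * a - |l| + b - 1) / b → |l| < (b : ℤ) * a := fun h => by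
        have := h2.2 h
        nlinarith
      omega
    · rw [← expI_add]
      ring_nf
  rw [h1]
  refine (norm_sum_le _ _).trans ?_
  have h2 : ∀ l ∈ Finset.Ioo (-((b : ℤ) * a)) (b * a), ‖expI (l * t) *
      ∑ g ∈ Finset.Ioo (-((min a ((b * a - |l| + b - 1) / b).toNat : ℕ) : ℤ))
        ((min a ((b * a - |l| + b - 1) / b).toNat : ℕ) : ℤ),
        expI (g * x - |(g : ℝ)| * 0)‖ ≤ 2 * peak a (x / 2) := fun l _ => by
    rw [norm_mul, norm_expI, one_mul]
    refine (norm_sum_Ioo_le_peak (min_le_left _ _) x 0).trans ?_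
    rw [sub_zero, add_zero]
    linarith
  refine (Finset.sum_le_card_nsmul _ _ _ h2).trans ?_
  rw [nsmul_eq_mul, Int.card_Ioo]
  have h3 : (((b : ℤ) * a - -(b * a) - 1).toNat : ℝ) ≤ 2 * (a * b) := by
    have : ((b : ℤ) * a - -(b * a) - 1).toNat ≤ 2 * (a * b) := by
      rw [Int.toNat_le]; push_cast; nlinarith
    exact_mod_cast this
  have := mul_le_mul_of_nonneg_right h3 (peak_nonneg a (x / 2))
  linarith

lemma sum_filter_even (f : ℕ → ℝ) (a q : ℕ) :
    ∑ i ∈ (Finset.range (2 * a)).filter (fun i => Even (i + q)), f i =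
      ∑ j ∈ Finset.range a, f (2 * j + q % 2) := by
  symm
  refine Finset.sum_nbij' (fun j => 2 * j + q % 2) (fun i => i / 2) ?_ ?_ ?_ ?_ ?_
  · intro j hj
    simp only [Finset.mem_filter, Finset.mem_range, Nat.even_iff] at *
    omega
  · intro j hj
    simp only [Finset.mem_filter, Finset.mem_range, Nat.even_iff] at *
    omega
  · intro j hj
    omega
  · intro j hj
    simp only [Finset.mem_filter, Finset.mem_range, Nat.even_iff] at *
    omega
  · intro j hj
    rfl

lemma sum_peak_parity_le {a : ℕ} (ha : 0 < a) (q : ℕ) (x : ℝ) :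
    ∑ i ∈ (Finset.range (2 * a)).filter (fun i => Even (i + q)), peak a ((x - i / a * π) / 2) ≤
      12 * a * Real.log (a + 1) := by
  rw [sum_filter_even (fun i => peak a ((x - i / a * π) / 2))]
  refine le_trans (le_of_eq ?_) (sum_peak_le ha (-(x / 2) + (q % 2 : ℕ) / a * π / 2))
  refine Finset.sum_congr rfl fun j _ => ?_
  rw [← peak_neg]
  congr 1
  push_cast
  field_simp
  ring

lemma sum_norm_rowSum_le {a b : ℕ} (ha : 0 < a) (hb : 0 < b) (q : ℕ) (x t : ℝ) :
    ∑ i ∈ (Finset.range (2 * a)).filter (fun i => Even (i + q)),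
        ‖rowSum a b (x - i / a * π) t‖ ≤
      2 * (12 * a * Real.log (a + 1)) * peak (2 * a * b) (t / 2) := by
  apply le_mul_peak
  · refine (Finset.sum_le_sum fun i _ => norm_rowSum_le a b hb _ t).trans ?_
    rw [← Finset.mul_sum]
    have := sum_peak_parity_le ha q x
    push_cast
    have h : (0 : ℝ) ≤ 4 * (a * b) := by positivity
    nlinarith
  · rw [Finset.mul_sum]
    refine (Finset.sum_le_sum fun i _ => norm_rowSum_mul_sin_le a b hb _ t).trans ?_
    rw [Finset.sum_add_distrib]
    have h1 := sum_peak_parity_le ha q (x - b * t)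
    have h2 := sum_peak_parity_le ha q (x + b * t)
    simp only [sub_right_comm _ ((b : ℝ) * t), add_sub_right_comm _ ((b : ℝ) * t)] at h1 h2
    linarith

/-- The exponential sum `∑ e^{i(γ₁ x + γ₂ y)}` over a finite set of frequencies. -/
noncomputable def kernelSum (D : Finset (ℤ × ℤ)) (x y : ℝ) : ℂ :=
  ∑ γ ∈ D, expI (γ.1 * x + γ.2 * y)

/-- Averaging over the `a` preimages of `y` under multiplication by `a` enforces the divisibility
`a ∣ l`. This replaces rows with rational endpoints by rows with integer endpoints. -/
lemma kernelSum_eq_average {a : ℕ} (ha : 0 < a) (S : ℤ → Finset ℤ) (D : Finset (ℤ × ℤ))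
    (hD : ∀ γ : ℤ × ℤ, γ ∈ D ↔ γ.1 ∈ Finset.Ioo (-(a : ℤ)) a ∧ a * γ.2 ∈ S γ.1) (x y : ℝ) :
    a * kernelSum D x y = ∑ k ∈ Finset.range a, ∑ g ∈ Finset.Ioo (-(a : ℤ)) a, ∑ l ∈ S g,
      expI (g * x + l * ((y + 2 * π * k) / a)) := by
  have ha' : (a : ℝ) ≠ 0 := by positivity
  rw [Finset.sum_comm]
  simp only [Finset.sum_comm (s := Finset.range a)]
  have h1 : ∀ g l : ℤ, ∑ k ∈ Finset.range a, expI (g * x + l * ((y + 2 * π * k) / a)) =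
      expI (g * x + l * (y / a)) * if (a : ℤ) ∣ l then (a : ℂ) else 0 := fun g l => by
    rw [← sum_expI_roots a ha, Finset.mul_sum]
    refine Finset.sum_congr rfl fun k _ => ?_
    rw [← expI_add]
    congr 1
    field_simp
    ring
  simp only [h1, mul_ite, mul_zero, ← Finset.sum_filter]
  rw [Finset.sum_sigma', kernelSum, Finset.mul_sum]
  refine Finset.sum_bij (fun γ _ => ⟨γ.1, a * γ.2⟩) ?_ ?_ ?_ ?_
  · intro γ hγ
    have := (hD γ).1 hγ
    simp only [Finset.mem_sigma, Finset.mem_filter]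
    exact ⟨this.1, this.2, dvd_mul_right _ _⟩
  · rintro ⟨g, l⟩ _ ⟨g', l'⟩ _ h
    simp only [Sigma.mk.injEq, heq_eq_eq] at h
    have ha'' : (a : ℤ) ≠ 0 := by exact_mod_cast ha.ne'
    rw [h.1, mul_left_cancel₀ ha'' h.2]
  · rintro ⟨g, l⟩ h
    simp only [Finset.mem_sigma, Finset.mem_filter] at h
    obtain ⟨h1, h2, m, rfl⟩ := h
    exact ⟨(g, m), (hD _).2 ⟨h1, h2⟩, rfl⟩
  · intro γ _
    rw [mul_comm]
    congr 2
    push_cast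
    field_simp

lemma sum_range_mul_eq (f : ℕ → ℝ) (m a : ℕ) :
    ∑ n ∈ Finset.range (m * a), f n =
      ∑ k ∈ Finset.range a, ∑ i ∈ Finset.range m, f (m * k + i) := by
  induction a with
  | zero => simp
  | succ a ih => rw [Nat.mul_succ, Finset.sum_range_add, ih, Finset.sum_range_succ]

/-- Lifting by `a` turns the second coordinates of the nodes into a full grid of `2 a b` points. -/
lemma sum_sum_peak_le {a b : ℕ} (ha : 0 < a) (hb : 0 < b) (y : ℝ) :
    ∑ i ∈ Finset.range (2 * b), ∑ k ∈ Finset.range a,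
        peak (2 * a * b) ((y - i / b * π + 2 * π * k) / a / 2) ≤
      12 * (2 * a * b) * Real.log (2 * a * b + 1) := by
  have hM : 0 < 2 * b * a := by positivity
  have h1 := sum_peak_le hM ((y - (2 * b - 1) / b * π) / a / 2)
  rw [sum_range_mul_eq, Finset.sum_comm, ← Finset.sum_range_reflect] at h1
  have hc : 2 * b * a = 2 * a * b := by ring
  rw [hc] at h1
  push_cast at h1
  refine le_trans (le_of_eq ?_) h1
  refine Finset.sum_congr rfl fun i hi => Finset.sum_congr rfl fun k _ => ?_
  have hi' : ((2 * b - 1 - i : ℕ) : ℝ) = 2 * b - 1 - i := by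
    have := Finset.mem_range.1 hi
    rw [Nat.cast_sub (by omega), Nat.cast_sub (by omega)]; simp
  congr 1
  rw [hi']
  field_simp
  ring

/-- Indices of the nodes on the torus `(ℝ / 2πℤ)²`, of which `indexSet` represents the orbits under
the glide reflection. -/
def torusIndex (a b : ℕ) : Finset (ℕ × ℕ) :=
  (Finset.range (2 * a) ×ˢ Finset.range (2 * b)).filter fun i => Even (i.1 + i.2)

lemma sum_torusIndex (a b : ℕ) (f : ℕ → ℕ → ℝ) :
    ∑ i ∈ torusIndex a b, f i.1 i.2 =
      ∑ q ∈ Finset.range (2 * b),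
        ∑ i ∈ (Finset.range (2 * a)).filter (fun i => Even (i + q)), f i q := by
  rw [torusIndex, Finset.sum_filter, Finset.sum_product_right]
  simp only [Finset.sum_filter]

/-- The sum over the torus nodes of the moduli of the translates of an exponential sum. -/
noncomputable def nodalNorm (a b : ℕ) (D : Finset (ℤ × ℤ)) (x y : ℝ) : ℝ :=
  ∑ i ∈ torusIndex a b, ‖kernelSum D (x - i.1 / a * π) (y - i.2 / b * π)‖

/-- The integer points of the open rhombus `|γ₁| / a + |γ₂| / b < 1`. -/
noncomputable def openRhombus (a b : ℕ) : Finset (ℤ × ℤ) :=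
  (Finset.Ioo (-(a : ℤ)) a ×ˢ Finset.Ioo (-(b : ℤ)) b).filter fun γ =>
    b * |γ.1| + a * |γ.2| < (a * b : ℤ)

/-- The integer points of the two lower edges of the rhombus, without the left and right
vertices. -/
noncomputable def lowerEdges (a b : ℕ) : Finset (ℤ × ℤ) :=
  (Finset.Ioo (-(a : ℤ)) a ×ˢ Finset.Ico (-(b : ℤ)) 0).filter fun γ =>
    b * |γ.1| + a * |γ.2| = (a * b : ℤ)

lemma mem_openRhombus {a b : ℕ} (ha : 0 < a) (hb : 0 < b) (γ : ℤ × ℤ) :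
    γ ∈ openRhombus a b ↔ γ.1 ∈ Finset.Ioo (-(a : ℤ)) a ∧
      a * γ.2 ∈ Finset.Ioo (-((b : ℤ) * (a - |γ.1|))) (b * (a - |γ.1|)) := by
  have ha' : (0 : ℤ) < a := by exact_mod_cast ha
  have hb' : (0 : ℤ) < b := by exact_mod_cast hb
  simp only [openRhombus, Finset.mem_filter, Finset.mem_product, Finset.mem_Ioo, ← abs_lt, abs_mul,
    abs_of_pos ha']
  have h1 := abs_nonneg γ.1
  have h2 : b * |γ.1| + a * |γ.2| < (a * b : ℤ) → |γ.2| < b := fun h => by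
    by_contra! h'
    nlinarith
  constructor
  · rintro ⟨⟨h3, h4⟩, h5⟩
    exact ⟨h3, by linarith⟩
  · rintro ⟨h3, h5⟩
    have : b * |γ.1| + a * |γ.2| < (a * b : ℤ) := by linarith
    exact ⟨⟨h3, h2 this⟩, this⟩

lemma mem_lowerEdges {a b : ℕ} (ha : 0 < a) (hb : 0 < b) (γ : ℤ × ℤ) :
    γ ∈ lowerEdges a b ↔ γ.1 ∈ Finset.Ioo (-(a : ℤ)) a ∧
      a * γ.2 ∈ ({-((b : ℤ) * (a - |γ.1|))} : Finset ℤ) := by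
  have ha' : (0 : ℤ) < a := by exact_mod_cast ha
  have hb' : (0 : ℤ) < b := by exact_mod_cast hb
  simp only [lowerEdges, Finset.mem_filter, Finset.mem_product, Finset.mem_Ioo, Finset.mem_Ico,
    Finset.mem_singleton]
  have h1 := abs_nonneg γ.1
  constructor
  · rintro ⟨⟨h3, h4⟩, h5⟩
    rw [abs_of_neg h4.2] at h5
    exact ⟨h3, by linarith⟩
  · rintro ⟨h3, h5⟩
    have h6 := abs_lt.2 h3
    have h7 : γ.2 < 0 := by
      by_contra! h'
      nlinarith
    rw [abs_of_neg h7]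
    refine ⟨⟨h3, ?_, h7⟩, by linarith⟩
    by_contra! h'
    nlinarith

/-- The asymmetric form of the estimate, sharp only when `a` is not much larger than `b`. -/
lemma nodalNorm_openRhombus_le_aux {a b : ℕ} (ha : 0 < a) (hb : 0 < b) (x y : ℝ) :
    nodalNorm a b (openRhombus a b) x y ≤
      576 * (a * b) * Real.log (a + 1) * Real.log (2 * a * b + 1) := by
  have ha' : (0 : ℝ) < a := by exact_mod_cast ha
  have hlog : 0 ≤ Real.log ((a : ℝ) + 1) := Real.log_nonneg (by linarith)
  have h1 : ∀ x y : ℝ, a * ‖kernelSum (openRhombus a b) x y‖ ≤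
      ∑ k ∈ Finset.range a, ‖rowSum a b x ((y + 2 * π * k) / a)‖ := fun x y => by
    have := congrArg norm (kernelSum_eq_average ha
      (fun g => Finset.Ioo (-((b : ℤ) * (a - |g|))) (b * (a - |g|))) _ (mem_openRhombus ha hb) x y)
    rw [norm_mul, Complex.norm_natCast] at this
    rw [this]
    exact norm_sum_le _ _
  have h2 : a * nodalNorm a b (openRhombus a b) x y ≤
      2 * (12 * a * Real.log (a + 1)) * (12 * (2 * a * b) * Real.log (2 * a * b + 1)) := by
    rw [nodalNorm, sum_torusIndex a b (fun i q =>
      ‖kernelSum (openRhombus a b) (x - i / a * π) (y - q / b * π)‖), Finset.mul_sum]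
    refine le_trans (Finset.sum_le_sum fun q _ => ?_)
      (le_trans (le_of_eq (Finset.mul_sum _ _ _).symm)
        (mul_le_mul_of_nonneg_left (sum_sum_peak_le ha hb y) (by positivity)))
    rw [Finset.mul_sum, Finset.mul_sum]
    refine (Finset.sum_le_sum fun i _ => h1 _ _).trans ?_
    rw [Finset.sum_comm]
    exact Finset.sum_le_sum fun k _ => sum_norm_rowSum_le ha hb q x _
  have h3 : 2 * (12 * a * Real.log (a + 1)) * (12 * (2 * a * b) * Real.log (2 * a * b + 1)) =
      a * (576 * (a * b) * Real.log (a + 1) * Real.log (2 * a * b + 1)) := by ring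
  rw [h3] at h2
  exact le_of_mul_le_mul_left h2 ha'

lemma nodalNorm_openRhombus_swap (a b : ℕ) (x y : ℝ) :
    nodalNorm a b (openRhombus a b) x y = nodalNorm b a (openRhombus b a) y x := by
  have h1 : ∀ x y, kernelSum (openRhombus a b) x y = kernelSum (openRhombus b a) y x := by
    intro x y
    refine Finset.sum_equiv (Equiv.prodComm ℤ ℤ) ?_ ?_
    · intro γ
      simp only [openRhombus, Finset.mem_filter, Finset.mem_product, Equiv.prodComm_apply,
        Prod.fst_swap, Prod.snd_swap]
      rw [add_comm, mul_comm (a : ℤ) b, and_comm (a := γ.1 ∈ _)]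
    · intro γ _
      simp [add_comm]
  refine Finset.sum_equiv (Equiv.prodComm ℕ ℕ) ?_ ?_
  · intro i
    simp only [torusIndex, Finset.mem_filter, Finset.mem_product, Equiv.prodComm_apply,
      Prod.fst_swap, Prod.snd_swap]
    rw [add_comm, and_comm (a := i.1 ∈ _)]
  · intro i _
    rw [h1]
    rfl

lemma log_two_mul_mul_le {a b : ℕ} (hab : a ≤ b) :
    Real.log (2 * a * b + 1) ≤ 3 * Real.log (b + 1) := by
  have h : (a : ℝ) ≤ b := by exact_mod_cast hab
  have h0 : (0 : ℝ) ≤ a := Nat.cast_nonneg a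
  have h1 : 3 * Real.log (b + 1) = Real.log (((b : ℝ) + 1) ^ 3) := by
    rw [Real.log_pow]; norm_num
  rw [h1]
  apply Real.log_le_log (by positivity)
  have : (a : ℝ) * b ≤ b * b := by gcongr
  have : 0 ≤ (b : ℝ) ^ 3 := by positivity
  nlinarith

/-- The rhombus is symmetric in its two axes, so the shorter axis may be taken as the first. -/
lemma nodalNorm_openRhombus_le {a b : ℕ} (ha : 0 < a) (hb : 0 < b) (x y : ℝ) :
    nodalNorm a b (openRhombus a b) x y ≤
      1728 * (a * b) * Real.log (a + 1) * Real.log (b + 1) := by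
  wlog hab : a ≤ b generalizing a b x y
  · rw [nodalNorm_openRhombus_swap]
    exact (this hb ha y x (by omega)).trans (le_of_eq (by ring))
  refine (nodalNorm_openRhombus_le_aux ha hb x y).trans ?_
  have hlog : 0 ≤ Real.log ((a : ℝ) + 1) :=
    Real.log_nonneg (by linarith [Nat.cast_nonneg (α := ℝ) a])
  have h : 0 ≤ 576 * ((a : ℝ) * b) * Real.log (a + 1) := by positivity
  have := mul_le_mul_of_nonneg_left (log_two_mul_mul_le hab) h
  linarith

/-- On the edges every row has at most one point, so that no division by `sin (t / 2)` occurs and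
one logarithm suffices. -/
lemma nodalNorm_lowerEdges_le {a b : ℕ} (ha : 0 < a) (hb : 0 < b) (x y : ℝ) :
    nodalNorm a b (lowerEdges a b) x y ≤ 48 * (a * b) * Real.log (a + 1) := by
  have ha' : (0 : ℝ) < a := by exact_mod_cast ha
  have h1 : ∀ x y : ℝ, a * ‖kernelSum (lowerEdges a b) x y‖ ≤
      ∑ k ∈ Finset.range a, (peak a ((x - -(b * ((y + 2 * π * k) / a))) / 2) +
        peak a ((x + -(b * ((y + 2 * π * k) / a))) / 2)) := fun x y => by
    have := congrArg norm (kernelSum_eq_average ha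
      (fun g => {-((b : ℤ) * (a - |g|))}) _ (mem_lowerEdges ha hb) x y)
    rw [norm_mul, Complex.norm_natCast] at this
    rw [this]
    refine (norm_sum_le _ _).trans (Finset.sum_le_sum fun k _ => ?_)
    refine le_trans (le_of_eq ?_) (norm_sum_Ioo_le_peak (le_refl a) _ _)
    set t := (y + 2 * π * k) / a
    rw [← one_mul ‖∑ g ∈ Finset.Ioo (-(a : ℤ)) a, expI (g * x - |(g : ℝ)| * (-(b * t)))‖,
      ← norm_expI (-(b * a * t)), ← norm_mul, Finset.mul_sum]
    congr 1
    refine Finset.sum_congr rfl fun g _ => ?_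
    rw [Finset.sum_singleton, ← expI_add]
    push_cast
    ring_nf
  have h2 : a * nodalNorm a b (lowerEdges a b) x y ≤
      a * (48 * (a * b) * Real.log (a + 1)) := by
    rw [nodalNorm, sum_torusIndex a b (fun i q =>
      ‖kernelSum (lowerEdges a b) (x - i / a * π) (y - q / b * π)‖), Finset.mul_sum]
    have h3 : ∀ q ∈ Finset.range (2 * b), a * ∑ i ∈ (Finset.range (2 * a)).filter
        (fun i => Even (i + q)), ‖kernelSum (lowerEdges a b) (x - i / a * π) (y - q / b * π)‖ ≤
        a * (24 * a * Real.log (a + 1)) := fun q _ => by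
      rw [Finset.mul_sum]
      refine (Finset.sum_le_sum fun i _ => h1 _ _).trans ?_
      rw [Finset.sum_comm]
      refine (Finset.sum_le_card_nsmul _ _ (24 * a * Real.log (a + 1)) fun k _ => ?_).trans
        (by rw [nsmul_eq_mul, Finset.card_range])
      rw [Finset.sum_add_distrib]
      set u := b * ((y - q / b * π + 2 * π * k) / a)
      have h4 := sum_peak_parity_le ha q (x - -u)
      have h5 := sum_peak_parity_le ha q (x + -u)
      simp only [sub_right_comm _ (-u), add_sub_right_comm _ (-u)] at h4 h5
      linarith
    refine (Finset.sum_le_card_nsmul _ _ _ h3).trans (le_of_eq ?_)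
    rw [nsmul_eq_mul, Finset.card_range]
    push_cast
    ring
  exact le_of_mul_le_mul_left h2 ha'

/-- The open rhombus with its lower edges, without the left and right vertices: a complete set of
representatives of the frequencies modulo aliasing on the torus nodes. -/
noncomputable def frequencySet (a b : ℕ) : Finset (ℤ × ℤ) := openRhombus a b ∪ lowerEdges a b

lemma disjoint_openRhombus_lowerEdges (a b : ℕ) :
    Disjoint (openRhombus a b) (lowerEdges a b) := by
  rw [Finset.disjoint_left]
  intro γ h1 h2
  exact absurd (Finset.mem_filter.1 h2).2 (Finset.mem_filter.1 h1).2.ne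

/-- The discrete Lebesgue-type estimate for the rhombic Dirichlet kernel. -/
lemma nodalNorm_frequencySet_le {a b : ℕ} (ha : 0 < a) (hb : 0 < b) (x y : ℝ) :
    nodalNorm a b (frequencySet a b) x y ≤
      2000 * (a * b) * Real.log (a + 1) * Real.log (b + 1) := by
  have h1 : nodalNorm a b (frequencySet a b) x y ≤
      nodalNorm a b (openRhombus a b) x y + nodalNorm a b (lowerEdges a b) x y := by
    rw [nodalNorm, nodalNorm, nodalNorm, ← Finset.sum_add_distrib]
    refine Finset.sum_le_sum fun i _ => ?_
    rw [frequencySet, kernelSum, Finset.sum_union (disjoint_openRhombus_lowerEdges a b)]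
    exact norm_add_le _ _
  have h2 := nodalNorm_openRhombus_le ha hb x y
  have h3 := nodalNorm_lowerEdges_le ha hb x y
  have hb' : (1 : ℝ) ≤ b := by exact_mod_cast hb
  have hlog : 0 ≤ Real.log ((a : ℝ) + 1) :=
    Real.log_nonneg (by linarith [Nat.cast_nonneg (α := ℝ) a])
  have h4 : Real.log 2 ≤ Real.log (b + 1) := Real.log_le_log (by norm_num) (by linarith)
  have h5 := Real.log_two_gt_d9
  have h6 : 0 ≤ ((a : ℝ) * b) * Real.log (a + 1) := by positivity
  nlinarith

/-! ### Representatives of the frequencies modulo aliasing -/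

lemma mem_frequencySet {a b : ℕ} (ha : 0 < a) (hb : 0 < b) (γ : ℤ × ℤ) :
    γ ∈ frequencySet a b ↔ b * |γ.1| + a * |γ.2| < (a * b : ℤ) ∨
      (γ.2 < 0 ∧ b * |γ.1| + a * |γ.2| = (a * b : ℤ)) := by
  have ha' : (0 : ℤ) < a := by exact_mod_cast ha
  have hb' : (0 : ℤ) < b := by exact_mod_cast hb
  have h1 := abs_nonneg γ.1
  have h2 := abs_nonneg γ.2
  simp only [frequencySet, Finset.mem_union, openRhombus, lowerEdges, Finset.mem_filter,
    Finset.mem_product, Finset.mem_Ioo, Finset.mem_Ico, ← abs_lt]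
  constructor
  · rintro (h | h)
    · exact Or.inl h.2
    · exact Or.inr ⟨h.1.2.2, h.2⟩
  · rintro (h | ⟨h, h'⟩)
    · refine Or.inl ⟨⟨?_, ?_⟩, h⟩ <;> by_contra! h3 <;> nlinarith
    · refine Or.inr ⟨⟨?_, ?_, h⟩, h'⟩
      · have : 0 < |γ.2| := abs_pos.2 h.ne
        by_contra! h3
        nlinarith
      · rw [abs_of_neg h] at h'
        by_contra! h3
        nlinarith

lemma reflect_mem_frequencySet {a b : ℕ} (ha : 0 < a) (hb : 0 < b) (γ : ℤ × ℤ) :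
    (-γ.1, γ.2) ∈ frequencySet a b ↔ γ ∈ frequencySet a b := by
  rw [mem_frequencySet ha hb, mem_frequencySet ha hb, abs_neg]

lemma kernelSum_frequencySet_neg {a b : ℕ} (ha : 0 < a) (hb : 0 < b) (x y : ℝ) :
    kernelSum (frequencySet a b) (-x) y = kernelSum (frequencySet a b) x y := by
  refine Finset.sum_nbij' (fun γ => (-γ.1, γ.2)) (fun γ => (-γ.1, γ.2)) ?_ ?_ ?_ ?_ ?_
  · intro γ hγ; exact (reflect_mem_frequencySet ha hb γ).2 hγ
  · intro γ hγ; exact (reflect_mem_frequencySet ha hb γ).2 hγ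
  · intro γ _; simp
  · intro γ _; simp
  · intro γ _; simp

/-- Moving the upper half of the rhombus down by `(±a, -b)` tiles a box: this is the change of
representatives modulo the lattice of aliasing frequencies. -/
lemma sum_frequencySet_eq_sum_box {a b : ℕ} (ha : 0 < a) (hb : 0 < b) {β : Type*}
    [AddCommMonoid β] (h : ℤ × ℤ → β) (h1 : ∀ γ, h (γ.1 - a, γ.2 - b) = h γ)
    (h2 : ∀ γ, h (γ.1 + a, γ.2 - b) = h γ) :
    ∑ γ ∈ frequencySet a b, h γ =
      ∑ γ ∈ Finset.Ico (-(a : ℤ)) a ×ˢ Finset.Ico (-(b : ℤ)) 0, h γ := by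
  have ha' : (0 : ℤ) < a := by exact_mod_cast ha
  have hb' : (0 : ℤ) < b := by exact_mod_cast hb
  refine Finset.sum_nbij'
    (fun γ => if γ.2 < 0 then γ else if 0 ≤ γ.1 then (γ.1 - a, γ.2 - b) else (γ.1 + a, γ.2 - b))
    (fun γ => if b * |γ.1| - a * γ.2 ≤ (a * b : ℤ) then γ else
      if γ.1 < 0 then (γ.1 + a, γ.2 + b) else (γ.1 - a, γ.2 + b)) ?_ ?_ ?_ ?_ ?_
  · rintro ⟨g, l⟩ hγ
    rw [mem_frequencySet ha hb] at hγ
    dsimp only at hγ ⊢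
    simp only [Finset.mem_product, Finset.mem_Ico]
    split_ifs with h3 h4
    · rw [abs_of_neg h3] at hγ
      have h5 : b * |g| + a * (-l) ≤ (a * b : ℤ) := by rcases hγ with h | h <;> linarith
      have h6 : |g| < a := by by_contra! h; nlinarith
      have h7 := abs_lt.1 h6
      have h8 := abs_nonneg g
      refine ⟨⟨by linarith, by linarith⟩, ?_, h3⟩
      by_contra! h; nlinarith
    · rw [abs_of_nonneg h4, abs_of_nonneg (not_lt.1 h3)] at hγ
      have h5 : b * g + a * l < (a * b : ℤ) := by rcases hγ with h | h <;> linarith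
      refine ⟨⟨?_, ?_⟩, ?_, ?_⟩ <;> simp only <;> by_contra! h <;> nlinarith
    · rw [abs_of_neg (not_le.1 h4), abs_of_nonneg (not_lt.1 h3)] at hγ
      have h5 : b * (-g) + a * l < (a * b : ℤ) := by rcases hγ with h | h <;> linarith
      refine ⟨⟨?_, ?_⟩, ?_, ?_⟩ <;> simp only <;> by_contra! h <;> nlinarith
  · rintro ⟨g, l⟩ hγ
    rw [mem_frequencySet ha hb]
    simp only [Finset.mem_product, Finset.mem_Ico] at hγ
    dsimp only
    split_ifs with h3 h4
    · dsimp only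
      rw [abs_of_neg hγ.2.2]
      rcases h3.lt_or_eq with h | h
      · left; linarith
      · right; exact ⟨hγ.2.2, by linarith⟩
    · left
      dsimp only
      rw [abs_of_neg h4] at h3
      rw [abs_of_nonneg (by linarith), abs_of_nonneg (by linarith)]
      nlinarith
    · left
      dsimp only
      rw [abs_of_nonneg (not_lt.1 h4)] at h3
      rw [abs_of_neg (by linarith), abs_of_nonneg (by linarith)]
      nlinarith
  · rintro ⟨g, l⟩ hγ
    rw [mem_frequencySet ha hb] at hγ
    dsimp only at hγ ⊢
    by_cases h3 : l < 0
    · rw [abs_of_neg h3] at hγ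
      have h5 : b * |g| - a * l ≤ (a * b : ℤ) := by rcases hγ with h | h <;> linarith
      simp [h3, h5]
    · have h3' := not_lt.1 h3
      rw [abs_of_nonneg h3'] at hγ
      have h5 : b * |g| + a * l < (a * b : ℤ) := by rcases hγ with h | h <;> linarith
      by_cases h4 : 0 ≤ g
      · rw [abs_of_nonneg h4] at h5
        have h6 : g - a < 0 := by by_contra! h; nlinarith
        have h7 : ¬ (b * |g - a| - a * (l - b) ≤ (a * b : ℤ)) := by
          rw [abs_of_neg h6]; nlinarith
        simp [h3, h4, h6, h7]
      · rw [abs_of_neg (not_le.1 h4)] at h5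
        have h6 : ¬ (g + a < 0) := by intro h; nlinarith
        have h7 : ¬ (b * |g + a| - a * (l - b) ≤ (a * b : ℤ)) := by
          rw [abs_of_nonneg (not_lt.1 h6)]; nlinarith
        simp [h3, h4, h6, h7]
  · rintro ⟨g, l⟩ hγ
    simp only [Finset.mem_product, Finset.mem_Ico] at hγ
    dsimp only
    by_cases h3 : b * |g| - a * l ≤ (a * b : ℤ)
    · simp [h3, hγ.2.2]
    · by_cases h4 : g < 0
      · have h5 : ¬ (l + b < 0) := by linarith
        have h6 : 0 ≤ g + a := by linarith
        simp [h3, h4, h5, h6]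
      · have h5 : ¬ (l + b < 0) := by linarith
        have h6 : ¬ ((a : ℤ) ≤ g) := by linarith
        simp [h3, h4, h5, h6]
  · rintro ⟨g, l⟩ _
    dsimp only
    split_ifs
    · rfl
    · exact (h1 (g, l)).symm
    · exact (h2 (g, l)).symm

lemma card_frequencySet {a b : ℕ} (ha : 0 < a) (hb : 0 < b) :
    (frequencySet a b).card = 2 * a * b := by
  rw [Finset.card_eq_sum_ones, sum_frequencySet_eq_sum_box ha hb _ (fun _ => rfl) (fun _ => rfl),
    ← Finset.card_eq_sum_ones, Finset.card_product, Int.card_Ico, Int.card_Ico]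
  congr 1 <;> omega

lemma sum_Ico_expI {n : ℕ} (hn : 0 < n) (c l : ℤ) :
    ∑ g ∈ Finset.Ico c (c + n), expI (g * (2 * π * l / n)) =
      if (n : ℤ) ∣ l then (n : ℂ) else 0 := by
  have h1 : ∑ g ∈ Finset.Ico c (c + n), expI (g * (2 * π * l / n)) =
      expI (c * (2 * π * l / n)) * ∑ k ∈ Finset.range n, expI (2 * π * k * l / n) := by
    rw [Finset.mul_sum]
    refine Finset.sum_nbij' (fun g => (g - c).toNat) (fun k => c + k) ?_ ?_ ?_ ?_ ?_
    · intro g hg; simp only [Finset.mem_Ico, Finset.mem_range] at *; omega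
    · intro g hg; simp only [Finset.mem_Ico, Finset.mem_range] at *; omega
    · intro g hg; simp only [Finset.mem_Ico] at *; omega
    · intro g hg; simp only [Finset.mem_range] at *; omega
    · intro g hg
      have h2 : (((g - c).toNat : ℕ) : ℝ) = g - c := by
        have : (((g - c).toNat : ℕ) : ℤ) = g - c := by simp only [Finset.mem_Ico] at *; omega
        exact_mod_cast congrArg (Int.cast (R := ℝ)) this
      rw [h2, ← expI_add]
      congr 1
      ring
  rw [h1, sum_expI_roots n hn]
  split_ifs with h
  · obtain ⟨q, rfl⟩ := h
    have hn' : (n : ℝ) ≠ 0 := by positivity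
    have : expI (c * (2 * π * ((n * q : ℤ) : ℝ) / n)) = 1 := by
      rw [← expI_two_pi_mul_int (c * q)]
      congr 1
      push_cast
      field_simp
    rw [this, one_mul]
  · rw [mul_zero]

/-- On differences of torus nodes the kernel is, up to the factor `2 a b`, a Kronecker delta. -/
lemma kernelSum_frequencySet_node {a b : ℕ} (ha : 0 < a) (hb : 0 < b) (d₁ d₂ : ℤ)
    (hd : Even (d₁ + d₂)) :
    kernelSum (frequencySet a b) (d₁ / a * π) (d₂ / b * π) =
      if ((2 * a : ℕ) : ℤ) ∣ d₁ ∧ ((2 * b : ℕ) : ℤ) ∣ d₂ then 2 * (a * b : ℂ) else 0 := by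
  have ha' : (a : ℝ) ≠ 0 := by positivity
  have hb' : (b : ℝ) ≠ 0 := by positivity
  rw [kernelSum, sum_frequencySet_eq_sum_box ha hb]
  · rw [Finset.sum_product]
    simp only [expI_add, ← Finset.mul_sum, ← Finset.sum_mul]
    have h1 := sum_Ico_expI (n := 2 * a) (by positivity) (-(a : ℤ)) d₁
    rw [show -(a : ℤ) + ((2 * a : ℕ) : ℤ) = a by push_cast; ring,
      show 2 * π * (d₁ : ℝ) / ((2 * a : ℕ) : ℝ) = d₁ / a * π by push_cast; field_simp] at h1
    rw [h1]
    by_cases h2 : ((2 * a : ℕ) : ℤ) ∣ d₁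
    · obtain ⟨m, rfl⟩ : ∃ m, d₂ = 2 * m := by
        obtain ⟨q, rfl⟩ := h2
        obtain ⟨r, hr⟩ := hd
        refine ⟨r - a * q, ?_⟩
        push_cast at hr
        linarith
      have h3 := sum_Ico_expI hb (-(b : ℤ)) m
      rw [show -(b : ℤ) + (b : ℤ) = 0 by ring,
        show 2 * π * (m : ℝ) / (b : ℝ) = ((2 * m : ℤ) : ℝ) / b * π by push_cast; ring] at h3
      rw [h3]
      have h4 : ((2 * b : ℕ) : ℤ) ∣ 2 * m ↔ (b : ℤ) ∣ m := by
        push_cast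
        exact mul_dvd_mul_iff_left two_ne_zero
      simp only [h2, h4, if_true, true_and]
      split_ifs
      · push_cast; ring
      · simp
    · rw [if_neg h2, zero_mul, if_neg fun h => h2 h.1]
  · intro γ
    obtain ⟨r, hr⟩ := hd
    rw [← one_mul (expI (_ + _)), ← expI_two_pi_mul_int r, ← expI_add]
    congr 1
    have hr' : (d₁ : ℝ) + d₂ = r + r := by exact_mod_cast hr
    push_cast
    field_simp
    linear_combination (-(a * b) : ℝ) * hr'
  · intro γ
    obtain ⟨r, hr⟩ := hd
    rw [← one_mul (expI (_ + _)), ← expI_two_pi_mul_int (r - d₁), ← expI_add]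
    congr 1
    have hr' : (d₁ : ℝ) + d₂ = r + r := by exact_mod_cast hr
    push_cast
    field_simp
    linear_combination (-(a * b) : ℝ) * hr'

/-! ### Cardinal functions, unisolvence and the Lebesgue constant -/

/-- The basis function `X_γ` as a trigonometric polynomial in two real variables: the average of an
exponential over the reflection `(x, y) ↦ (-x, y + π)`. -/
noncomputable def glideExp (γ : ℤ × ℤ) (x y : ℝ) : ℂ :=
  (expI (γ.1 * x + γ.2 * y) + expI (γ.1 * -x + γ.2 * (y + π))) / 2

lemma expI_int_mul_pi (m : ℤ) : expI (m * π) = if Even m then 1 else -1 := by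
  split_ifs with h
  · obtain ⟨k, rfl⟩ := h
    rw [← expI_two_pi_mul_int k]
    congr 1
    push_cast; ring
  · obtain ⟨k, rfl⟩ := Int.not_even_iff_odd.1 h
    have : ((2 * k + 1 : ℤ) : ℝ) * π = 2 * π * k + π := by push_cast; ring
    rw [this, expI_add, expI_two_pi_mul_int, one_mul, expI, Complex.exp_pi_mul_I]

lemma fourierBasis_apply (γ : ℤ × ℤ) (p : Rect) :
    fourierBasis γ p = glideExp γ p.1 p.2 := by
  have h1 : ∀ x y : ℝ, glideExp γ x y =
      (expI (γ.1 * x) + (if Even γ.2 then 1 else -1) * expI (-(γ.1 * x))) / 2 *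
        expI (γ.2 * y) := fun x y => by
    rw [glideExp, ← expI_int_mul_pi, mul_add, expI_add, expI_add, expI_add, mul_neg]
    ring
  have h2 : ∀ t : ℝ, (Real.cos t : ℂ) = (expI t + expI (-t)) / 2 := fun t => by
    rw [Complex.ofReal_cos, Complex.cos, expI, expI]
    push_cast
    rfl
  have h3 : ∀ t : ℝ, Complex.I * (Real.sin t : ℂ) = (expI t - expI (-t)) / 2 := fun t => by
    rw [Complex.ofReal_sin, Complex.sin, expI, expI]
    push_cast
    linear_combination (Complex.exp (-(t : ℂ) * Complex.I) - Complex.exp (t * Complex.I)) / 2 *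
      Complex.I_mul_I
  have h4 : ∀ y : ℝ, Complex.exp (Complex.I * γ.2 * (y : ℂ)) = expI (γ.2 * y) := fun y => by
    rw [expI]
    push_cast
    ring_nf
  rw [h1]
  change (if Even γ.2 then _ else _) = _
  split_ifs
  · rw [h2, h4]; ring
  · rw [h3, h4]; ring

lemma norm_glideExp_le (γ : ℤ × ℤ) (x y : ℝ) : ‖glideExp γ x y‖ ≤ 1 := by
  rw [glideExp, norm_div]
  have := norm_add_le (expI (γ.1 * x + γ.2 * y)) (expI (γ.1 * -x + γ.2 * (y + π)))
  rw [norm_expI, norm_expI] at this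
  rw [Complex.norm_ofNat, div_le_one (by norm_num)]
  linarith

/-- The reproducing kernel of the `X_γ` is the average of four values of the exponential kernel. -/
lemma sum_glideExp_mul_conj (D : Finset (ℤ × ℤ)) (x y u v : ℝ) :
    ∑ γ ∈ D, glideExp γ x y * (starRingEnd ℂ) (glideExp γ u v) =
      (kernelSum D (x - u) (y - v) + kernelSum D (x + u) (y - π - v) +
        kernelSum D (-x - u) (y + π - v) + kernelSum D (-x + u) (y - v)) / 4 := by
  simp only [kernelSum, ← Finset.sum_add_distrib, Finset.sum_div]
  refine Finset.sum_congr rfl fun γ _ => ?_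
  simp only [glideExp, map_div₀, map_add, conj_expI, map_ofNat]
  have h : ∀ s t w : ℝ, s + t = w → expI s * expI t = expI w := fun s t w h => by
    rw [← expI_add, h]
  have h1 := h (γ.1 * x + γ.2 * y) (-(γ.1 * u + γ.2 * v)) (γ.1 * (x - u) + γ.2 * (y - v)) (by ring)
  have h2 := h (γ.1 * x + γ.2 * y) (-(γ.1 * -u + γ.2 * (v + π)))
    (γ.1 * (x + u) + γ.2 * (y - π - v)) (by ring)
  have h3 := h (γ.1 * -x + γ.2 * (y + π)) (-(γ.1 * u + γ.2 * v))
    (γ.1 * (-x - u) + γ.2 * (y + π - v)) (by ring)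
  have h4 := h (γ.1 * -x + γ.2 * (y + π)) (-(γ.1 * -u + γ.2 * (v + π)))
    (γ.1 * (-x + u) + γ.2 * (y - v)) (by ring)
  linear_combination (h1 + h2 + h3 + h4) / 4

/-- Membership in the spectral set in integer form; the bound `γ₁ ≤ a` is redundant. -/
lemma mem_spectralSet {a b : ℕ} (ha : 0 < a) (hb : 0 < b) (γ : ℤ × ℤ) :
    γ ∈ spectralSet a b ↔
      (1 ≤ γ.1 ∧ b * γ.1 + a * |γ.2| ≤ (a * b : ℤ) ∧
        ¬ (b * γ.1 + a * γ.2 = (a * b : ℤ) ∧ γ.2 ≠ 0)) ∨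
      (γ.1 = 0 ∧ Even γ.2 ∧ |γ.2| < b) := by
  have ha' : (0 : ℤ) < a := by exact_mod_cast ha
  have hb' : (0 : ℤ) < b := by exact_mod_cast hb
  have haR : (0 : ℝ) < a := by exact_mod_cast ha
  have hbR : (0 : ℝ) < b := by exact_mod_cast hb
  have h1 : (γ.1 : ℝ) / a + |(γ.2 : ℝ)| / b ≤ 1 ↔ b * γ.1 + a * |γ.2| ≤ (a * b : ℤ) := by
    rw [div_add_div _ _ haR.ne' hbR.ne', div_le_one (by positivity), mul_comm (γ.1 : ℝ)]
    exact_mod_cast Iff.rfl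
  have h2 : (γ.1 : ℝ) / a + (γ.2 : ℝ) / b = 1 ↔ b * γ.1 + a * γ.2 = (a * b : ℤ) := by
    rw [div_add_div _ _ haR.ne' hbR.ne', div_eq_one_iff_eq (by positivity), mul_comm (γ.1 : ℝ)]
    exact_mod_cast Iff.rfl
  have h3 := abs_nonneg γ.2
  simp only [spectralSet, upperSpectralSet, bigSpectralSet, Set.mem_sdiff, Set.mem_union,
    Set.mem_ofPred_eq, h1, h2]
  have h4 : 1 ≤ γ.1 → b * γ.1 + a * |γ.2| ≤ (a * b : ℤ) → γ.1 ≤ a := fun _ h => by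
    by_contra! h'; nlinarith
  have h5 : γ.1 = 0 → |γ.2| < b → ¬ (b * γ.1 + a * γ.2 = (a * b : ℤ)) := fun h h' h'' => by
    have := le_abs_self γ.2
    rw [h] at h''
    nlinarith
  constructor
  · rintro ⟨⟨h6, _, h7⟩ | h6, h8⟩
    · exact Or.inl ⟨h6, h7, fun h9 => h8 ⟨Or.inl ⟨h6, h4 h6 h7, h7⟩, h9⟩⟩
    · exact Or.inr h6
  · rintro (⟨h6, h7, h8⟩ | ⟨h6, h7, h8⟩)
    · exact ⟨Or.inl ⟨h6, h4 h6 h7, h7⟩, fun h => h8 h.2⟩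
    · exact ⟨Or.inr ⟨h6, h7, h8⟩, fun h => h5 h6 h8 h.2.1⟩

/-- The cardinal function of the node with index `i`: it is one there and zero at the others.
The frequency `(0, -b)` of the complete set of representatives is exchanged for the equivalent
`(a, 0)`, which lies in the spectral set. -/
noncomputable def cardinalFun (a b : ℕ) (i : indexSet a b) : C(Rect, ℂ) :=
  (1 / (a * b) : ℂ) • (∑ γ ∈ (frequencySet a b).erase (0, -(b : ℤ)),
      (starRingEnd ℂ) (fourierBasis γ (node a b i)) • fourierBasis γ +
    (starRingEnd ℂ) (fourierBasis (a, 0) (node a b i)) • fourierBasis (a, 0))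

lemma fourierBasis_reflect (γ : ℤ × ℤ) :
    fourierBasis (-γ.1, γ.2) = (if Even γ.2 then 1 else -1 : ℂ) • fourierBasis γ := by
  ext p
  rw [ContinuousMap.smul_apply, smul_eq_mul, fourierBasis_apply, fourierBasis_apply, glideExp,
    glideExp, ← expI_int_mul_pi]
  have h1 : expI (γ.2 * π) * expI (γ.2 * π) = 1 := by
    rw [← expI_add, ← expI_two_pi_mul_int γ.2]
    congr 1; ring
  have h2 : expI (γ.1 * -(p.1 : ℝ) + γ.2 * ((p.2 : ℝ) + π)) =
      expI (γ.1 * -(p.1 : ℝ) + γ.2 * (p.2 : ℝ)) * expI (γ.2 * π) := by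
    rw [← expI_add]; congr 1; ring
  have h3 : expI (γ.1 * (p.1 : ℝ) + γ.2 * ((p.2 : ℝ) + π)) =
      expI (γ.1 * (p.1 : ℝ) + γ.2 * (p.2 : ℝ)) * expI (γ.2 * π) := by
    rw [← expI_add]; congr 1; ring
  push_cast
  simp only [neg_mul, mul_neg, neg_neg] at *
  rw [h2, h3]
  linear_combination (-(1 : ℂ) / 2 * expI (-(γ.1 * (p.1 : ℝ)) + γ.2 * (p.2 : ℝ))) * h1

lemma fourierBasis_mem_interpolationSpace {a b : ℕ} (ha : 0 < a) (hb : 0 < b) {γ : ℤ × ℤ}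
    (hγ : γ ∈ (frequencySet a b).erase (0, -(b : ℤ))) :
    fourierBasis γ ∈ interpolationSpace a b := by
  have ha' : (0 : ℤ) < a := by exact_mod_cast ha
  have hb' : (0 : ℤ) < b := by exact_mod_cast hb
  obtain ⟨h0, hγ⟩ := Finset.mem_erase.1 hγ
  have hpos : ∀ γ ∈ frequencySet a b, 0 < γ.1 → fourierBasis γ ∈ interpolationSpace a b := by
    intro γ hγ hp
    refine Submodule.subset_span ⟨γ, (mem_spectralSet ha hb γ).2 (Or.inl ⟨hp, ?_, ?_⟩), rfl⟩
    · rw [mem_frequencySet ha hb, abs_of_pos hp] at hγ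
      rcases hγ with h | h <;> linarith
    · rintro ⟨h1, h2⟩
      rw [mem_frequencySet ha hb, abs_of_pos hp] at hγ
      rcases hγ with h | h
      · have := le_abs_self γ.2
        nlinarith
      · rw [abs_of_neg h.1] at h
        nlinarith
  rcases lt_trichotomy γ.1 0 with h | h | h
  · have h1 := hpos _ ((reflect_mem_frequencySet ha hb γ).2 hγ) (by simpa using h)
    have h2 := fourierBasis_reflect (-γ.1, γ.2)
    simp only [neg_neg] at h2
    rw [show γ = (γ.1, γ.2) from rfl, h2]
    exact Submodule.smul_mem _ _ h1
  · by_cases h2 : Even γ.2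
    · refine Submodule.subset_span ⟨γ, (mem_spectralSet ha hb γ).2 (Or.inr ⟨h, h2, ?_⟩), rfl⟩
      rw [mem_frequencySet ha hb, h, abs_zero, mul_zero, zero_add] at hγ
      rcases hγ with h3 | ⟨h3, h4⟩
      · by_contra! h'; nlinarith
      · exfalso
        apply h0
        rw [abs_of_neg h3] at h4
        have := mul_left_cancel₀ ha'.ne' h4
        ext
        · exact h
        · simp only; linarith
    -- For `γ₁ = 0` and `γ₂` odd the function `X_γ` is its own negative.
    · have h3 : fourierBasis γ = 0 := by
        have h4 := fourierBasis_reflect γ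
        rw [if_neg h2, h, neg_zero] at h4
        rw [show (0, γ.2) = γ from Prod.ext h.symm rfl] at h4
        ext p
        have h5 := DFunLike.congr_fun h4 p
        rw [ContinuousMap.smul_apply, smul_eq_mul, neg_one_mul] at h5
        exact self_eq_neg.1 h5
      rw [h3]
      exact Submodule.zero_mem _
  · exact hpos γ hγ h

lemma cardinalFun_mem {a b : ℕ} (ha : 0 < a) (hb : 0 < b) (i : indexSet a b) :
    cardinalFun a b i ∈ interpolationSpace a b := by
  refine Submodule.smul_mem _ _ (Submodule.add_mem _ (Submodule.sum_mem _ fun γ hγ =>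
    Submodule.smul_mem _ _ (fourierBasis_mem_interpolationSpace ha hb hγ))
    (Submodule.smul_mem _ _ (Submodule.subset_span ⟨_, (mem_spectralSet ha hb _).2 ?_, rfl⟩)))
  left
  have : (1 : ℤ) ≤ a := by exact_mod_cast ha
  refine ⟨this, ?_, by simp⟩
  simp [mul_comm]

lemma vertex_mem_frequencySet {a b : ℕ} (ha : 0 < a) (hb : 0 < b) :
    ((0 : ℤ), -(b : ℤ)) ∈ frequencySet a b := by
  rw [mem_frequencySet ha hb]
  right
  simp [hb]

lemma cardinalFun_apply {a b : ℕ} (ha : 0 < a) (hb : 0 < b) (i : indexSet a b) (p : Rect) :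
    cardinalFun a b i p = (1 / (a * b) : ℂ) *
      ((∑ γ ∈ frequencySet a b, glideExp γ p.1 p.2 *
          (starRingEnd ℂ) (glideExp γ (node a b i).1 (node a b i).2)) +
        (glideExp (a, 0) p.1 p.2 *
            (starRingEnd ℂ) (glideExp (a, 0) (node a b i).1 (node a b i).2) -
          glideExp (0, -(b : ℤ)) p.1 p.2 *
            (starRingEnd ℂ) (glideExp (0, -(b : ℤ)) (node a b i).1 (node a b i).2))) := by
  rw [← Finset.add_sum_erase _ _ (vertex_mem_frequencySet ha hb)]
  simp only [cardinalFun, ContinuousMap.smul_apply, ContinuousMap.add_apply,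
    ContinuousMap.sum_apply, smul_eq_mul, fourierBasis_apply]
  simp only [mul_comm ((starRingEnd ℂ) _)]
  ring

lemma mem_indexSet_iff {a b : ℕ} (i : ℕ × ℕ) :
    i ∈ indexSet a b ↔ (i.1 < a + 1 ∧ i.2 < 2 * b) ∧
      ((i.1 = 0 ∨ i.1 = a) → i.2 < b) ∧ Even (i.1 + i.2) := by
  simp [indexSet]

/-- The frequencies `(a, 0)` and `(0, -b)` cannot be distinguished on the nodes. -/
lemma glideExp_vertex_node {a b : ℕ} (ha : 0 < a) (hb : 0 < b) (he : Even b) (i : indexSet a b) :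
    glideExp (a, 0) (node a b i).1 (node a b i).2 =
      glideExp (0, -(b : ℤ)) (node a b i).1 (node a b i).2 := by
  have haR : (a : ℝ) ≠ 0 := by positivity
  have hbR : (b : ℝ) ≠ 0 := by positivity
  obtain ⟨_, _, hi⟩ := (mem_indexSet_iff _).1 i.2
  have h1 : ((i.1.1 : ℤ) : ℝ) * π = ((a : ℤ) : ℝ) * (i.1.1 / a * π) := by
    push_cast; field_simp
  have h1' : ((-(i.1.1 : ℤ) : ℤ) : ℝ) * π = ((a : ℤ) : ℝ) * -(i.1.1 / a * π) := by
    push_cast; field_simp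
  have h2 : ((-(i.1.2 : ℤ) : ℤ) : ℝ) * π = ((-(b : ℤ) : ℤ) : ℝ) * (i.1.2 / b * π) := by
    push_cast; field_simp
  have h3 : ((-(i.1.2 : ℤ) - b : ℤ) : ℝ) * π = ((-(b : ℤ) : ℤ) : ℝ) * (i.1.2 / b * π + π) := by
    push_cast; field_simp
    ring
  simp only [glideExp, node, Int.cast_zero, zero_mul, zero_add, add_zero, ← h1, ← h1', ← h2, ← h3,
    expI_int_mul_pi]
  have h4 : Even (i.1.1 : ℤ) ↔ Even (i.1.2 : ℤ) := by
    have := Nat.even_add.1 hi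
    exact_mod_cast this
  have h5 : Even (b : ℤ) := by exact_mod_cast he
  simp only [Int.even_sub, even_neg, h4, h5, iff_true]

lemma cardinalFun_node {a b : ℕ} (ha : 0 < a) (hb : 0 < b) (he : Even b) (i j : indexSet a b) :
    cardinalFun a b i (node a b j) = if i = j then 1 else 0 := by
  have haC : (a : ℂ) ≠ 0 := by exact_mod_cast ha.ne'
  have hbC : (b : ℂ) ≠ 0 := by exact_mod_cast hb.ne'
  have hbR : (b : ℝ) ≠ 0 := by positivity
  rw [cardinalFun_apply ha hb, glideExp_vertex_node ha hb he, glideExp_vertex_node ha hb he,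
    sub_self, add_zero, sum_glideExp_mul_conj]
  obtain ⟨⟨i1, i2⟩, i3, i4⟩ := (mem_indexSet_iff _).1 i.2
  obtain ⟨⟨j1, j2⟩, j3, j4⟩ := (mem_indexSet_iff _).1 j.2
  have hij : i = j ↔ i.1.1 = j.1.1 ∧ i.1.2 = j.1.2 := by
    rw [Subtype.ext_iff, Prod.ext_iff]
  obtain ⟨⟨p, q⟩, hi⟩ := i
  obtain ⟨⟨r, s⟩, hj⟩ := j
  simp only at i1 i2 i3 i4 j1 j2 j3 j4 hij
  simp only [hij, node]
  have he' : Even (b : ℤ) := by exact_mod_cast he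
  have i4' : Even ((p : ℤ) + q) := by exact_mod_cast i4
  have j4' : Even ((r : ℤ) + s) := by exact_mod_cast j4
  have k1 := kernelSum_frequencySet_node ha hb ((r : ℤ) - p) (s - q) (by
    have := j4'.sub i4'
    rwa [show (r : ℤ) - p + (s - q) = r + s - (p + q) by ring])
  have k2 := kernelSum_frequencySet_node ha hb ((r : ℤ) + p) (s - b - q) (by
    obtain ⟨u, hu⟩ := i4'; obtain ⟨v, hv⟩ := j4'; obtain ⟨w, hw⟩ := he'
    exact ⟨v + p - u - w, by linarith⟩)
  have k3 := kernelSum_frequencySet_node ha hb (-(r : ℤ) - p) (s + b - q) (by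
    obtain ⟨u, hu⟩ := i4'; obtain ⟨v, hv⟩ := j4'; obtain ⟨w, hw⟩ := he'
    exact ⟨v - r - u + w, by linarith⟩)
  have k4 := kernelSum_frequencySet_node ha hb (-(r : ℤ) + p) (s - q) (by
    obtain ⟨u, hu⟩ := i4'; obtain ⟨v, hv⟩ := j4'
    exact ⟨v - r + p - u, by linarith⟩)
  have e1 : (((r : ℤ) - p : ℤ) : ℝ) / a * π = r / a * π - p / a * π := by push_cast; ring
  have e2 : (((s : ℤ) - q : ℤ) : ℝ) / b * π = s / b * π - q / b * π := by push_cast; ring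
  have e3 : (((r : ℤ) + p : ℤ) : ℝ) / a * π = r / a * π + p / a * π := by push_cast; ring
  have e4 : (((s : ℤ) - b - q : ℤ) : ℝ) / b * π = s / b * π - π - q / b * π := by
    push_cast; field_simp
  have e5 : ((-(r : ℤ) - p : ℤ) : ℝ) / a * π = -(r / a * π) - p / a * π := by push_cast; ring
  have e6 : (((s : ℤ) + b - q : ℤ) : ℝ) / b * π = s / b * π + π - q / b * π := by
    push_cast; field_simp
  have e7 : ((-(r : ℤ) + p : ℤ) : ℝ) / a * π = -(r / a * π) + p / a * π := by push_cast; ring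
  rw [e1, e2] at k1
  rw [e3, e4] at k2
  rw [e5, e6] at k3
  rw [e7, e2] at k4
  rw [k1, k2, k3, k4]
  -- A multiple of `n` of absolute value below `n` vanishes.
  have small : ∀ {n : ℕ} {z : ℤ}, -(n : ℤ) < z → z < n → (n : ℤ) ∣ z → z = 0 := by
    intro n z h1 h2 h3
    exact Int.eq_zero_of_abs_lt_dvd h3 (abs_lt.2 ⟨h1, h2⟩)
  have c1 : (((2 * a : ℕ) : ℤ) ∣ (r : ℤ) - p ∧ ((2 * b : ℕ) : ℤ) ∣ (s : ℤ) - q) ↔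
      (p = r ∧ q = s) := by
    constructor
    · rintro ⟨h1, h2⟩
      have h3 := small (by omega) (by omega) h1
      have h4 := small (by omega) (by omega) h2
      omega
    · rintro ⟨rfl, rfl⟩; simp
  have c4 : (((2 * a : ℕ) : ℤ) ∣ -(r : ℤ) + p ∧ ((2 * b : ℕ) : ℤ) ∣ (s : ℤ) - q) ↔
      (p = r ∧ q = s) := by
    rw [← c1, ← dvd_neg, show -(-(r : ℤ) + p) = r - p by ring]
  -- A node and the reflection of a node can share the first coordinate only at a pole, where the
  -- second indices lie below `b`.
  have hpr : ((2 * a : ℕ) : ℤ) ∣ (r : ℤ) + p → q < b ∧ s < b := fun h => by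
    have : (p = 0 ∧ r = 0) ∨ (p = a ∧ r = a) := by
      obtain ⟨m, hm⟩ := h
      have hm0 : 0 ≤ m := by
        by_contra! h'
        have : (r : ℤ) + p < 0 := by
          rw [hm]; exact mul_neg_of_pos_of_neg (by omega) h'
        omega
      have hm1 : m ≤ 1 := by
        by_contra! h'
        have : ((2 * a : ℕ) : ℤ) * 2 ≤ (2 * a : ℕ) * m :=
          mul_le_mul_of_nonneg_left (by omega) (by omega)
        omega
      obtain rfl | rfl : m = 0 ∨ m = 1 := by omega
      · omega
      · omega
    omega
  have c2 : ¬ (((2 * a : ℕ) : ℤ) ∣ (r : ℤ) + p ∧ ((2 * b : ℕ) : ℤ) ∣ (s : ℤ) - b - q) := by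
    rintro ⟨h1, h2⟩
    have h3 := hpr h1
    have := small (by omega) (by omega) h2
    omega
  have c3 : ¬ (((2 * a : ℕ) : ℤ) ∣ -(r : ℤ) - p ∧ ((2 * b : ℕ) : ℤ) ∣ (s : ℤ) + b - q) := by
    rintro ⟨h1, h2⟩
    have h3 := hpr (by rw [← dvd_neg] at h1; rwa [show -(-(r : ℤ) - p) = r + p by ring] at h1)
    have := small (by omega) (by omega) h2
    omega
  rw [if_neg c2, if_neg c3, if_congr c1 rfl rfl, if_congr c4 rfl rfl]
  split_ifs
  · field_simp
    ring
  · simp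

lemma indexSet_subset_torusIndex {a : ℕ} (ha : 0 < a) (b : ℕ) :
    indexSet a b ⊆ torusIndex a b := by
  intro i hi
  obtain ⟨h1, _, h2⟩ := (mem_indexSet_iff _).1 hi
  simp only [torusIndex, Finset.mem_filter, Finset.mem_product, Finset.mem_range]
  exact ⟨⟨by omega, h1.2⟩, h2⟩

lemma sum_indexSet_norm_kernelSum_le {a b : ℕ} (ha : 0 < a) (hb : 0 < b) (x y : ℝ) :
    ∑ i : indexSet a b,
        ‖kernelSum (frequencySet a b) (x - (node a b i).1) (y - (node a b i).2)‖ ≤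
      2000 * (a * b) * Real.log (a + 1) * Real.log (b + 1) := by
  refine le_trans ?_ (nodalNorm_frequencySet_le ha hb x y)
  simp only [node]
  rw [Finset.sum_coe_sort (indexSet a b) (fun i =>
    ‖kernelSum (frequencySet a b) (x - i.1 / a * π) (y - i.2 / b * π)‖)]
  exact Finset.sum_le_sum_of_subset_of_nonneg (indexSet_subset_torusIndex ha b)
    fun _ _ _ => norm_nonneg _

/-- The bound for the Lebesgue function. -/
lemma sum_norm_cardinalFun_le {a b : ℕ} (ha : 0 < a) (hb : 0 < b) (p : Rect) :
    ∑ i : indexSet a b, ‖cardinalFun a b i p‖ ≤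
      2020 * Real.log (a + 1) * Real.log (b + 1) := by
  have haR : (1 : ℝ) ≤ a := by exact_mod_cast ha
  have hbR : (1 : ℝ) ≤ b := by exact_mod_cast hb
  set D := frequencySet a b
  set x : ℝ := (p.1 : ℝ)
  set y : ℝ := (p.2 : ℝ)
  have h1 : ∀ i : indexSet a b, a * b * ‖cardinalFun a b i p‖ ≤
      (‖kernelSum D (x - (node a b i).1) (y - (node a b i).2)‖ +
        ‖kernelSum D (-x - (node a b i).1) (y - π - (node a b i).2)‖ +
        ‖kernelSum D (-x - (node a b i).1) (y + π - (node a b i).2)‖ +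
        ‖kernelSum D (x - (node a b i).1) (y - (node a b i).2)‖) / 4 + 2 := by
    intro i
    rw [cardinalFun_apply ha hb, sum_glideExp_mul_conj, norm_mul]
    have hn : ‖(1 / (a * b) : ℂ)‖ = 1 / (a * b) := by simp
    rw [hn, ← mul_assoc, mul_one_div_cancel (by positivity), one_mul]
    refine (norm_add_le _ _).trans (add_le_add ?_ ?_)
    · rw [norm_div, Complex.norm_ofNat]
      refine div_le_div_of_nonneg_right ?_ (by norm_num)
      have e1 : kernelSum D (x + (node a b i).1) (y - π - (node a b i).2) =
          kernelSum D (-x - (node a b i).1) (y - π - (node a b i).2) := by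
        rw [← kernelSum_frequencySet_neg ha hb]
        congr 1; ring
      have e2 : kernelSum D (-x + (node a b i).1) (y - (node a b i).2) =
          kernelSum D (x - (node a b i).1) (y - (node a b i).2) := by
        rw [← kernelSum_frequencySet_neg ha hb]
        congr 1; ring
      rw [e1, e2]
      exact norm_add₄_le
    · have h2 : ∀ γ : ℤ × ℤ, ‖glideExp γ x y *
          (starRingEnd ℂ) (glideExp γ (node a b i).1 (node a b i).2)‖ ≤ 1 := fun γ => by
        rw [norm_mul, RCLike.norm_conj]
        exact mul_le_one₀ (norm_glideExp_le _ _ _) (norm_nonneg _) (norm_glideExp_le _ _ _)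
      refine (norm_sub_le _ _).trans ?_
      linarith [h2 (a, 0), h2 (0, -(b : ℤ))]
  have h2 := Finset.sum_le_sum fun i (_ : i ∈ (Finset.univ : Finset (indexSet a b))) => h1 i
  rw [← Finset.mul_sum, Finset.sum_add_distrib, ← Finset.sum_div, Finset.sum_add_distrib,
    Finset.sum_add_distrib, Finset.sum_add_distrib, Finset.sum_const, nsmul_eq_mul,
    Finset.card_univ, Fintype.card_coe] at h2
  have k1 := sum_indexSet_norm_kernelSum_le ha hb x y
  have k2 := sum_indexSet_norm_kernelSum_le ha hb (-x) (y - π)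
  have k3 := sum_indexSet_norm_kernelSum_le ha hb (-x) (y + π)
  have hcard : ((indexSet a b).card : ℝ) ≤ 4 * (a * b) := by
    have : (indexSet a b).card ≤ 2 * a * (2 * b) := by
      refine (Finset.card_le_card (indexSet_subset_torusIndex ha b)).trans
        ((Finset.card_filter_le _ _).trans ?_)
      rw [Finset.card_product, Finset.card_range, Finset.card_range]
    have h := Nat.cast_le (α := ℝ).2 this
    push_cast at h
    linarith
  set LA := Real.log (a + 1)
  set LB := Real.log (b + 1)
  have l1 : Real.log 2 ≤ LA := Real.log_le_log (by norm_num) (by linarith)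
  have l2 : Real.log 2 ≤ LB := Real.log_le_log (by norm_num) (by linarith)
  have l3 := Real.log_two_gt_d9
  have l4 : 8 ≤ 20 * (LA * LB) := by nlinarith
  have hab : (0 : ℝ) < a * b := by positivity
  have l5 := mul_le_mul_of_nonneg_left l4 hab.le
  refine le_of_mul_le_mul_left ?_ hab
  refine h2.trans ?_
  nlinarith

/-- There are at least `a b` nodes: each `i₁` strictly between `0` and `a` carries `b` of them, and
the two poles carry `b / 2` each. -/
lemma le_card_indexSet {a b : ℕ} (ha : 0 < a) (he : Even b) :
    a * b ≤ (indexSet a b).card := by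
  obtain ⟨c, rfl⟩ := he
  have h : (Finset.range a ×ˢ Finset.range (c + c)).card ≤ (indexSet a (c + c)).card := by
    refine Finset.card_le_card_of_injOn
      (fun i => if 0 < i.1 then (i.1, 2 * i.2 + i.1 % 2) else
        if i.2 < c then (0, 2 * i.2) else (a, 2 * (i.2 - c) + a % 2)) ?_ ?_
    · rintro ⟨p, q⟩ h
      simp only [Finset.coe_product, Finset.coe_range, Set.mem_prod, Set.mem_Iio] at h
      dsimp only
      rw [Finset.mem_coe, mem_indexSet_iff]
      split_ifs <;> dsimp only <;> rw [Nat.even_iff] <;> omega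
    · rintro ⟨p, q⟩ h ⟨r, s⟩ h'
      simp only [Finset.coe_product, Finset.coe_range, Set.mem_prod, Set.mem_Iio] at h h'
      dsimp only
      split_ifs <;> simp only [Prod.mk.injEq] <;> omega
  rwa [Finset.card_product, Finset.card_range, Finset.card_range] at h

/-- A finite set containing the spectral set, in three parts: the vertex `(a, 0)`, the other
elements with `γ₁ > 0`, and the axis `γ₁ = 0`. -/
noncomputable def spectralFinset (a b : ℕ) : Finset (ℤ × ℤ) :=
  insert ((a : ℤ), (0 : ℤ)) ((frequencySet a b).filter (fun γ => 0 < γ.1) ∪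
    (Finset.Ioo (-((b / 2 : ℕ) : ℤ)) ((b / 2 : ℕ) : ℤ)).image fun k => ((0 : ℤ), 2 * k))

lemma spectralSet_subset_spectralFinset {a b : ℕ} (ha : 0 < a) (hb : 0 < b) (he : Even b) :
    spectralSet a b ⊆ spectralFinset a b := by
  have ha' : (0 : ℤ) < a := by exact_mod_cast ha
  have hb' : (0 : ℤ) < b := by exact_mod_cast hb
  obtain ⟨c, hc⟩ := he
  rintro ⟨g, l⟩ hγ
  rw [Finset.mem_coe, spectralFinset, Finset.mem_insert, Finset.mem_union, Finset.mem_filter,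
    mem_frequencySet ha hb]
  rcases (mem_spectralSet ha hb _).1 hγ with ⟨h1, h2, h3⟩ | ⟨h1, h2, h3⟩
  · dsimp only at h1 h2 h3 ⊢
    rw [abs_of_pos (by linarith : 0 < g)]
    rcases lt_trichotomy l 0 with h | h | h
    · right; left
      refine ⟨?_, by linarith⟩
      rcases h2.lt_or_eq with h4 | h4
      · exact Or.inl h4
      · exact Or.inr ⟨h, h4⟩
    · subst h
      rw [abs_zero, mul_zero, add_zero] at h2
      rcases h2.lt_or_eq with h4 | h4
      · right; left
        rw [abs_zero, mul_zero, add_zero]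
        exact ⟨Or.inl h4, by linarith⟩
      · left
        rw [mul_comm] at h4
        rw [mul_right_cancel₀ hb'.ne' h4]
    · right; left
      refine ⟨Or.inl (lt_of_le_of_ne h2 fun h4 => h3 ⟨?_, h.ne'⟩), by linarith⟩
      rwa [abs_of_pos h] at h4
  · right; right
    dsimp only at h1 h2 h3
    obtain ⟨k, hk⟩ := h2
    rw [abs_lt] at h3
    refine Finset.mem_image.2 ⟨k, Finset.mem_Ioo.2 ⟨by omega, by omega⟩, ?_⟩
    rw [h1, hk, two_mul]

/-- The part of the rhombus with `γ₁ > 0`, its mirror image and the axis make up at most the `2 a b`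
elements of `frequencySet`. -/
lemma card_spectralFinset_le {a b : ℕ} (ha : 0 < a) (hb : 0 < b) :
    (spectralFinset a b).card ≤ a * b := by
  have ha' : (0 : ℤ) < a := by exact_mod_cast ha
  have hb' : (0 : ℤ) < b := by exact_mod_cast hb
  set P := (frequencySet a b).filter (fun γ => 0 < γ.1) with hP
  set N := P.image (fun γ : ℤ × ℤ => (-γ.1, γ.2)) with hN
  set Z := (Finset.Ico (-(b : ℤ)) b).image (fun l => ((0 : ℤ), l)) with hZ
  have hNc : N.card = P.card := Finset.card_image_of_injective _ fun γ γ' h => by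
    simpa [Prod.ext_iff] using h
  have hZc : Z.card = 2 * b := by
    rw [hZ, Finset.card_image_of_injective _ (Prod.mk_right_injective _), Int.card_Ico]
    omega
  have hN' : ∀ γ ∈ N, γ.1 < 0 := by
    intro γ h
    obtain ⟨γ', h', rfl⟩ := Finset.mem_image.1 h
    simpa using (Finset.mem_filter.1 h').2
  have hZ' : ∀ γ ∈ Z, γ.1 = 0 := by
    intro γ h
    obtain ⟨l, _, rfl⟩ := Finset.mem_image.1 h
    rfl
  have d1 : Disjoint P N := Finset.disjoint_left.2 fun γ h h' => by
    have := (Finset.mem_filter.1 h).2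
    have := hN' γ h'
    omega
  have d2 : Disjoint (P ∪ N) Z := Finset.disjoint_left.2 fun γ h h' => by
    have h0 := hZ' γ h'
    rcases Finset.mem_union.1 h with h | h
    · have := (Finset.mem_filter.1 h).2
      omega
    · have := hN' γ h
      omega
  have hsub : P ∪ N ∪ Z ⊆ frequencySet a b := by
    refine Finset.union_subset (Finset.union_subset (Finset.filter_subset _ _) ?_) ?_
    · intro γ h
      obtain ⟨γ', h', rfl⟩ := Finset.mem_image.1 h
      exact (reflect_mem_frequencySet ha hb γ').2 (Finset.mem_filter.1 h').1
    · intro γ h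
      obtain ⟨l, hl, rfl⟩ := Finset.mem_image.1 h
      rw [Finset.mem_Ico] at hl
      rw [mem_frequencySet ha hb]
      simp only [abs_zero, mul_zero, zero_add]
      rcases lt_or_ge l 0 with h | h
      · rw [abs_of_neg h]
        rcases (show -l ≤ b by linarith).lt_or_eq with h1 | h1
        · left; nlinarith
        · right; exact ⟨h, by rw [h1]⟩
      · rw [abs_of_nonneg h]
        left; nlinarith
  have h1 := Finset.card_le_card hsub
  rw [Finset.card_union_of_disjoint d2, Finset.card_union_of_disjoint d1, hNc, hZc,
    card_frequencySet ha hb] at h1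
  have h2 : ((Finset.Ioo (-((b / 2 : ℕ) : ℤ)) ((b / 2 : ℕ) : ℤ)).image
      fun k => ((0 : ℤ), 2 * k)).card ≤ b - 1 := by
    refine Finset.card_image_le.trans ?_
    rw [Int.card_Ioo]
    omega
  have h3 := Finset.card_insert_le ((a : ℤ), (0 : ℤ)) (P ∪
    (Finset.Ioo (-((b / 2 : ℕ) : ℤ)) ((b / 2 : ℕ) : ℤ)).image fun k => ((0 : ℤ), 2 * k))
  have h4 := Finset.card_union_le P
    ((Finset.Ioo (-((b / 2 : ℕ) : ℤ)) ((b / 2 : ℕ) : ℤ)).image fun k => ((0 : ℤ), 2 * k))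
  rw [spectralFinset, ← hP]
  have h5 : 2 * a * b = 2 * (a * b) := by ring
  omega

/-- Interpolants are unique: evaluation at the nodes is onto, by the cardinal functions, and the
interpolation space has no more dimensions than there are nodes. -/
lemma eq_zero_of_vanishing {a b : ℕ} (ha : 0 < a) (hb : 0 < b) (he : Even b) {P : C(Rect, ℂ)}
    (hP : P ∈ interpolationSpace a b) (h0 : ∀ i, P (node a b i) = 0) : P = 0 := by
  classical
  have hle : interpolationSpace a b ≤
      Submodule.span ℂ ((spectralFinset a b).image fourierBasis : Set C(Rect, ℂ)) := by
    rw [Finset.coe_image]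
    exact Submodule.span_mono (Set.image_mono (spectralSet_subset_spectralFinset ha hb he))
  have hfin : FiniteDimensional ℂ
      (Submodule.span ℂ ((spectralFinset a b).image fourierBasis : Set C(Rect, ℂ))) :=
    FiniteDimensional.span_finset ℂ _
  have hfin' : FiniteDimensional ℂ (interpolationSpace a b) :=
    Submodule.finiteDimensional_of_le hle
  have hdim : Module.finrank ℂ (interpolationSpace a b) ≤ (indexSet a b).card :=
    (Submodule.finrank_mono hle).trans ((finrank_span_finset_le_card _).trans
      (Finset.card_image_le.trans ((card_spectralFinset_le ha hb).trans
        (le_card_indexSet ha he))))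
  let ev : interpolationSpace a b →ₗ[ℂ] (indexSet a b → ℂ) :=
    { toFun := fun Q i => (Q : C(Rect, ℂ)) (node a b i)
      map_add' := fun _ _ => rfl
      map_smul' := fun _ _ => rfl }
  have hsurj : Function.Surjective ev := by
    intro f
    refine ⟨∑ i, f i • ⟨cardinalFun a b i, cardinalFun_mem ha hb i⟩, ?_⟩
    rw [map_sum]
    ext j
    rw [Finset.sum_apply, Finset.sum_eq_single j]
    · simp [ev, cardinalFun_node ha hb he]
    · intro i _ hij
      simp [ev, cardinalFun_node ha hb he, hij]
    · simp
  have hcard : Module.finrank ℂ (indexSet a b → ℂ) = (indexSet a b).card := by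
    rw [Module.finrank_fintype_fun_eq_card, Fintype.card_coe]
  have heq : Module.finrank ℂ (interpolationSpace a b) =
      Module.finrank ℂ (indexSet a b → ℂ) :=
    le_antisymm (hdim.trans hcard.ge) (LinearMap.finrank_le_finrank_of_surjective hsurj)
  have hinj := (LinearMap.injective_iff_surjective_of_finrank_eq_finrank (K := ℂ)
    (V := interpolationSpace a b) (V₂ := indexSet a b → ℂ) heq (f := ev)).2 hsurj
  have : (⟨P, hP⟩ : interpolationSpace a b) = 0 := hinj (by
    rw [map_zero]
    exact funext h0)
  exact congrArg Subtype.val this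

lemma isInterpolant_sum_cardinalFun {a b : ℕ} (ha : 0 < a) (hb : 0 < b) (he : Even b)
    (f : indexSet a b → ℂ) : IsInterpolant a b f (∑ i, f i • cardinalFun a b i) := by
  refine ⟨Submodule.sum_mem _ fun i _ => Submodule.smul_mem _ _ (cardinalFun_mem ha hb i),
    fun j => ?_⟩
  rw [ContinuousMap.sum_apply, Finset.sum_eq_single j]
  · simp [cardinalFun_node ha hb he]
  · intro i _ hij
    simp [cardinalFun_node ha hb he, hij]
  · simp

lemma IsInterpolant.eq_sum_cardinalFun {a b : ℕ} (ha : 0 < a) (hb : 0 < b) (he : Even b)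
    {f : indexSet a b → ℂ} {P : C(Rect, ℂ)} (hP : IsInterpolant a b f P) :
    P = ∑ i, f i • cardinalFun a b i := by
  have h := isInterpolant_sum_cardinalFun ha hb he f
  refine sub_eq_zero.1 (eq_zero_of_vanishing ha hb he (Submodule.sub_mem _ hP.1 h.1) fun i => ?_)
  rw [ContinuousMap.sub_apply, hP.2, h.2, sub_self]

lemma norm_sum_cardinalFun_le {a b : ℕ} (ha : 0 < a) (hb : 0 < b) {f : indexSet a b → ℂ}
    (hf : ∀ i, ‖f i‖ ≤ 1) :
    ‖∑ i, f i • cardinalFun a b i‖ ≤ 2020 * Real.log (a + 1) * Real.log (b + 1) := by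
  have haR : (0 : ℝ) ≤ Real.log (a + 1) :=
    Real.log_nonneg (by linarith [Nat.cast_nonneg (α := ℝ) a])
  have hbR : (0 : ℝ) ≤ Real.log (b + 1) :=
    Real.log_nonneg (by linarith [Nat.cast_nonneg (α := ℝ) b])
  refine (ContinuousMap.norm_le _ (by positivity)).2 fun p => ?_
  rw [ContinuousMap.sum_apply]
  refine (norm_sum_le _ _).trans (le_trans (Finset.sum_le_sum fun i _ => ?_)
    (sum_norm_cardinalFun_le ha hb p))
  rw [ContinuousMap.smul_apply, norm_smul]
  exact mul_le_of_le_one_left (norm_nonneg _) (hf i)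

end SphericalLissajous

theorem mainTheorem3 :
    ∃ C : ℝ, 0 < C ∧ ∀ m₁ m₂ : ℕ, 0 < m₁ → 0 < m₂ → Even m₂ →
      (∀ f : SphericalLissajous.indexSet m₁ m₂ → ℂ,
        ∃! P : C(SphericalLissajous.Rect, ℂ), SphericalLissajous.IsInterpolant m₁ m₂ f P) ∧
      SphericalLissajous.lebesgueConstant m₁ m₂ ≤
        ENNReal.ofReal (C * Real.log (m₁ + 1) * Real.log (m₂ + 1)) := by
  refine ⟨2020, by norm_num, fun a b ha hb he => ⟨fun f => ⟨_,
    SphericalLissajous.isInterpolant_sum_cardinalFun ha hb he f,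
    fun P hP => hP.eq_sum_cardinalFun ha hb he⟩, ?_⟩⟩
  refine iSup₂_le fun F hF => iSup₂_le fun P hP => ?_
  rw [hP.eq_sum_cardinalFun ha hb he, ← ofReal_norm]
  exact ENNReal.ofReal_le_ofReal (SphericalLissajous.norm_sum_cardinalFun_le ha hb fun i =>
    (F.norm_coe_le_norm _).trans hF.2)
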